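/- Two source nodes $A$ and $B$ exchange packets of $\ell>0$ bits over a relay $D$. The channel capacities (bits per unit time) from $A$ to $D$, $D$ to $B$, $B$ to $D$ and $D$ to $A$ are positive constants $C_{AD},C_{DB},C_{BD},C_{DA}$; put $C_{\min}=\min\{C_{DA},C_{DB}\}$. Define the rate regions of time-division multihop (TDMH) and MAC-layer network coding (MLNC) by $$\mathcal R_{\mathrm{TDMH}}=\Big\{(R_{AB},R_{BA})\in[0,\infty)^2:\ \exists\,\lambda\in[0,1]^4,\ \sum_{k=1}^4\lambda_k=1,\ R_{AB}\le\lambda_1C_{AD},\ R_{AB}\le\lambda_2C_{DB},\ R_{BA}\le\lambda_3C_{BD},\ R_{BA}\le\lambda_4C_{DA}\Big\},$$ $$\mathcal R_{\mathrm{MLNC}}=\Big\{(R_{AB},R_{BA})\in[0,\infty)^2:\ \exists\,\lambda\in[0,1]^3,\ \sum_{k=1}^3\lambda_k=1,\ R_{AB}\le\lambda_1C_{AD},\ R_{AB}\le\lambda_3C_{\min},\ R_{BA}\le\lambda_2C_{BD},\ R_{BA}\le\lambda_3C_{\min}\Big\}.$$ Packets arrive at $A$ and at $B$ according to two independent Poisson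 processes with rates $r_A$ and $r_B$ (packets per unit time) and are stored in two infinite queues of lengths $q_A,q_B$. The opportunistic MLNC scheduling algorithm acts as follows whenever the previous transmission is complete. (1) If $q_A\neq0$ and $q_B\neq0$, one packet from each queue is sent over $D$ by MLNC, which takes time $\ell(1/C_{AD}+1/C_{BD}+1/C_{\min})$. (2) If $q_A\ne0$ and $q_B=0$, one packet from $A$ is sent over $D$ by TDMH, which takes time $\ell(1/C_{AD}+1/C_{DB})$. (3) If $q_A=0$ and $q_B\neq0$, one packet from $B$ is sent over $D$ by TDMH, which takes time $\ell(1/C_{BD}+1/C_{DA})$. If both queues are empty, the system waits for the next arrival and then applies the rule. Let $Q(n)=(q_A(n),q_B(n))$ be the queue lengths right after the $n$-th transmission, starting from any given initial queue lengths $Q(0)$ at time $0$. If the pair of bit-arrival rates $(R_{AB},R_{BA})=(r_A\ell,r_B\ell)$ lies in the interior of the convex hull of $\mathcal R_{\mathrm{TDMH}}\cup\mathcal R_{\mathrm{MLNC}}$, then the algorithm stabilizes the system: $(Q(n))_{n\ge0}$ is an irreducible, positive recurrent time-homogeneous Markov chain on $\mathbb N^2$ (with $\mathbb N=\{0,1,2,\dots\}$).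 -/

import Mathlib

open MeasureTheory ProbabilityTheory
open scoped NNReal ENNReal

noncomputable section

namespace TwoWayRelay

/-- The (positive) channel capacities, in bits per unit of time, of the four links between the
source nodes `A`, `B` and the relay node `D`; `AD` is the capacity from `A` to `D`, etc. -/
structure Capacities where
  AD : ℝ≥0
  DB : ℝ≥0
  BD : ℝ≥0
  DA : ℝ≥0
  AD_pos : 0 < AD
  DB_pos : 0 < DB
  BD_pos : 0 < BD
  DA_pos : 0 < DA

/-- The broadcast rate of the relay under MAC-layer network coding. -/
def Capacities.Cmin (C : Capacities) : ℝ≥0 := min C.DA C.DB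

/-- Rate region of time-division multihop: four time slots `A → D`, `D → B`, `B → D`, `D → A` that
occupy the fractions `w 0, w 1, w 2, w 3` of the time. -/
def regionTDMH (C : Capacities) : Set (ℝ × ℝ) :=
  {R | 0 ≤ R.1 ∧ 0 ≤ R.2 ∧ ∃ w : Fin 4 → ℝ, (∀ k, w k ∈ Set.Icc (0 : ℝ) 1) ∧ ∑ k, w k = 1 ∧
    R.1 ≤ w 0 * C.AD ∧ R.1 ≤ w 1 * C.DB ∧ R.2 ≤ w 2 * C.BD ∧ R.2 ≤ w 3 * C.DA}

/-- Rate region of MAC-layer network coding: three time slots `A → D`, `B → D` and the broadcast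
from `D` to both sources, that occupy the fractions `w 0, w 1, w 2` of the time. -/
def regionMLNC (C : Capacities) : Set (ℝ × ℝ) :=
  {R | 0 ≤ R.1 ∧ 0 ≤ R.2 ∧ ∃ w : Fin 3 → ℝ, (∀ k, w k ∈ Set.Icc (0 : ℝ) 1) ∧ ∑ k, w k = 1 ∧
    R.1 ≤ w 0 * C.AD ∧ R.1 ≤ w 2 * C.Cmin ∧ R.2 ≤ w 1 * C.BD ∧ R.2 ≤ w 2 * C.Cmin}

/-- `N` is (the counting process of) a Poisson process of rate `r` on the half-line. Its paths are
nondecreasing and right-continuous, so the subtraction in `ℕ` below is never truncated. -/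
structure IsPoissonProcess {Ω : Type*} [MeasurableSpace Ω] (N : ℝ≥0 → Ω → ℕ) (r : ℝ≥0)
    (μ : Measure Ω) : Prop where
  measurable : ∀ t, Measurable (N t)
  zero : ∀ ω, N 0 ω = 0
  mono : ∀ ω, Monotone fun t => N t ω
  rightCont : ∀ ω t, ContinuousWithinAt (fun u => N u ω) (Set.Ici t) t
  indep : HasIndepIncrements N μ
  law : ∀ s t, s ≤ t → μ.map (fun ω => N t ω - N s ω) = poissonMeasure (r * (t - s))

/-- The numbers of packets taken from the queues `(q_A, q_B)` in the next transmission: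
one from each queue if both are nonempty, one from the nonempty queue if only one is nonempty. -/
def departures (q : ℕ × ℕ) : ℕ × ℕ :=
  if q.1 ≠ 0 ∧ q.2 ≠ 0 then (1, 1)
  else if q.1 ≠ 0 then (1, 0)
  else if q.2 ≠ 0 then (0, 1)
  else (0, 0)

/-- The duration of the next transmission, for packets of `ℓ` bits: a pair of packets is exchanged
by MLNC, a single packet is sent over the relay by TDMH. -/
def duration (C : Capacities) (ℓ : ℝ≥0) (q : ℕ × ℕ) : ℝ≥0 :=
  if q.1 ≠ 0 ∧ q.2 ≠ 0 then ℓ / C.AD + ℓ / C.BD + ℓ / C.Cmin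
  else if q.1 ≠ 0 then ℓ / C.AD + ℓ / C.DB
  else if q.2 ≠ 0 then ℓ / C.BD + ℓ / C.DA
  else 0

/-- The first time after `s` at which one of the arrival counts `a`, `b` has increased. (The value
is the meaningless `0` if there are no more arrivals, which has probability zero for Poisson
arrivals of positive rate.) -/
def nextArrival (a b : ℝ≥0 → ℕ) (s : ℝ≥0) : ℝ≥0 :=
  sInf {u | s ≤ u ∧ (a s < a u ∨ b s < b u)}

/-- The time at which the next transmission starts, if the previous one ended at time `s` and left
the queues `q`: at once if there is a packet to send, else at the next arrival. -/
def startTime (a b : ℝ≥0 → ℕ) (s : ℝ≥0) (q : ℕ × ℕ) : ℝ≥0 :=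
  if q = (0, 0) then nextArrival a b s else s

/-- The queues at time `t`, if they are `q` at time `s` and nothing is sent in between; `a` and `b`
count the arrivals at the two nodes. -/
def withArrivals (a b : ℝ≥0 → ℕ) (s t : ℝ≥0) (q : ℕ × ℕ) : ℕ × ℕ :=
  (q.1 + (a t - a s), q.2 + (b t - b s))

/-- From (time, queues) right after a transmission to (time, queues) right after the next one. -/
def step (C : Capacities) (ℓ : ℝ≥0) (a b : ℝ≥0 → ℕ) (x : ℝ≥0 × (ℕ × ℕ)) : ℝ≥0 × (ℕ × ℕ) :=
  let s := startTime a b x.1 x.2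
  let q := withArrivals a b x.1 s x.2
  let t := s + duration C ℓ q
  (t, withArrivals a b s t (q - departures q))

/-- The queue lengths `(q_A, q_B)` right after the `n`-th transmission of the opportunistic
scheduling algorithm, when the queues are `q₀` at time `0` and the arrivals at nodes `A` and `B` are
counted by `NA` and `NB`. -/
def queues {Ω : Type*} (C : Capacities) (ℓ : ℝ≥0) (NA NB : ℝ≥0 → Ω → ℕ) (q₀ : ℕ × ℕ) (n : ℕ)
    (ω : Ω) : ℕ × ℕ :=
  ((step C ℓ (fun t => NA t ω) (fun t => NB t ω))^[n] (0, q₀)).2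

/-- The first time `n ≥ 1` at which the process `X` is in the state `x` (`∞` if there is none). -/
def returnTime {Ω S : Type*} (X : ℕ → Ω → S) (x : S) (ω : Ω) : ℝ≥0∞ :=
  ⨅ (n : ℕ) (_ : 1 ≤ n ∧ X n ω = x), (n : ℝ≥0∞)

/-- `X` is a time-homogeneous Markov chain with transition probabilities `P`, started at `x`,
on a countable state space. -/
structure IsMarkovChain {Ω S : Type*} [MeasurableSpace Ω] [MeasurableSpace S] (μ : Measure Ω)
    (P : S → PMF S) (x : S) (X : ℕ → Ω → S) : Prop where
  measurable : ∀ n, Measurable (X n)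
  start : ∀ ω, X 0 ω = x
  markov : ∀ (n : ℕ) (s : ℕ → S),
    μ {ω | ∀ k ≤ n + 1, X k ω = s k} = μ {ω | ∀ k ≤ n, X k ω = s k} * P (s n) (s (n + 1))

/-- Stability of a system with countably many states, where `X x` is the state process started at
`x`: it is an irreducible, positive recurrent (time-homogeneous) Markov chain. -/
def IsStable {Ω S : Type*} [MeasurableSpace Ω] [MeasurableSpace S] (μ : Measure Ω)
    (X : S → ℕ → Ω → S) : Prop :=
  (∃ P : S → PMF S, ∀ x, IsMarkovChain μ P x (X x)) ∧
  (∀ x y, ∃ n, 0 < μ {ω | X x n ω = y}) ∧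
  (∀ x, ∫⁻ ω, returnTime (X x) x ω ∂μ < ∞)

end TwoWayRelay

end

/-!
Let `TA`, `TB`, `TM` be the durations of the three kinds of transmission. Both rate regions, hence
the convex hull of their union, lie between the axes and the two lines
`rA * TA + rB * (TM - TA) = 1` and `rA * (TM - TB) + rB * TB = 1` (`load_le_one`), so that rates in
the interior of the hull are positive and make both loads smaller than `1` (`load_lt_one`).

*Markov property.* The state is started afresh at the end of each transmission: the arrivals from
then on are independent of the queue lengths seen so far and have the law of all arrivals
(`IsPoissonLaw.measure_history_inter_shift`). To prove this, the pair of Poisson processes is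
considered as a random element of the space `ArrivalPath` of right-continuous counting paths. Its
law is known on cylinders, which gives the Markov property at fixed times
(`IsPoissonLaw.measure_eval_inter_shift`). As transmissions have fixed durations, the only random
time that is needed is the first arrival after the system became empty; there the strong Markov
property follows by approximation with the points of finer and finer grids
(`IsPoissonLaw.measure_firstArrival_inter_shift`).

*Positive recurrence.* The quadratic form with the matrix `(α, β; β, γ)`, where
`α = (TM - TB) * TA`, `β = (TM - TB) * (TM - TA)`, `γ = (TM - TA) * TB`, is a Lyapunov function: the
two rows of the matrix are multiples of `(TA, TM - TA)` and `(TM - TB, TB)`. Along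
both of these directions the mean drift is negative if both queues are nonempty; if one of them is
empty, only the direction that belongs to the other one enters (`exists_lyapunov`). Hence the mean
of the form decreases by at least `1` in each transmission, up to finitely many states
(`IsPoissonLaw.exists_drift`), and Foster's criterion applies
(`IsMarkovChain.lintegral_returnTime_lt_top`).

*Irreducibility.* With positive probability no packet arrives during a transmission, and any number
of packets arrives during the last one (`IsPoissonLaw.transGen_leads`).
-/

noncomputable section

namespace TwoWayRelay

open Filter Topology

/-! ### Foster's criterion for Markov chains on a countable state space -/

section Foster

variable {Ω S : Type*} {P : S → PMF S} {x : S} {X : ℕ → Ω → S}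

/-- The event `A` is determined by the first `n + 1` values `X 0, …, X n` of the process. -/
def DeterminedBy (X : ℕ → Ω → S) (n : ℕ) (A : Set Ω) : Prop :=
  ∀ ω ω', (∀ k ≤ n, X k ω = X k ω') → ω ∈ A → ω' ∈ A

lemma DeterminedBy.mono {m n : ℕ} (h : m ≤ n) {A : Set Ω} (hA : DeterminedBy X m A) :
    DeterminedBy X n A :=
  fun ω ω' H => hA ω ω' fun k hk => H k (hk.trans h)

lemma DeterminedBy.inter {n : ℕ} {A B : Set Ω} (hA : DeterminedBy X n A)
    (hB : DeterminedBy X n B) : DeterminedBy X n (A ∩ B) :=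
  fun ω ω' H h => ⟨hA ω ω' H h.1, hB ω ω' H h.2⟩

lemma determinedBy_eq (n : ℕ) (y : S) : DeterminedBy X n {ω | X n ω = y} :=
  fun _ _ H h => (H n le_rfl).symm.trans h

/-- The event that the process does not visit `x` at the times `1, …, n`. -/
def notReturned (X : ℕ → Ω → S) (x : S) (n : ℕ) : Set Ω :=
  {ω | ∀ k, 1 ≤ k → k ≤ n → X k ω ≠ x}

lemma determinedBy_notReturned (n : ℕ) : DeterminedBy X n (notReturned X x n) :=
  fun _ _ H h k hk hkn e => h k hk hkn ((H k hkn).trans e)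

lemma notReturned_anti : Antitone (notReturned X x) :=
  fun _ _ hmn _ h k hk hkn => h k hk (hkn.trans hmn)

lemma returnTime_le_tsum_indicator (X : ℕ → Ω → S) (x : S) (ω : Ω) :
    returnTime X x ω ≤ ∑' n, (notReturned X x n).indicator 1 ω := by
  classical
  by_cases h : ∃ k, 1 ≤ k ∧ X k ω = x
  · refine (iInf₂_le (Nat.find h) (Nat.find_spec h)).trans ?_
    refine le_trans ?_ (ENNReal.sum_le_tsum (Finset.range (Nat.find h)))
    rw [Finset.sum_congr rfl (g := fun _ => (1 : ℝ≥0∞))]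
    · simp
    · intro n hn
      refine Set.indicator_of_mem (fun k hk hkn e => ?_) _
      exact Nat.find_min h (lt_of_le_of_lt hkn (Finset.mem_range.1 hn)) ⟨hk, e⟩
  · push Not at h
    have : ∀ n, (notReturned X x n).indicator (1 : Ω → ℝ≥0∞) ω = 1 := fun n =>
      Set.indicator_of_mem (show ω ∈ notReturned X x n from fun k hk _ => h k hk) _
    simp [this]

/-- The `k`-step transition probabilities of the transition kernel `P`. -/
def stepProb (P : S → PMF S) : ℕ → S → S → ℝ≥0∞
  | 0, y, z => (PMF.pure y) z
  | k + 1, y, z => ∑' u, stepProb P k y u * P u z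

/-- The edges of the transition graph of the kernel `P`. -/
def Leads (P : S → PMF S) (y z : S) : Prop := P y z ≠ 0

lemma exists_stepProb_ne_zero {y z : S} (h : Relation.TransGen (Leads P) y z) :
    ∃ k, 1 ≤ k ∧ stepProb P k y z ≠ 0 := by
  induction h with
  | single h =>
    refine ⟨1, le_rfl, ?_⟩
    simp only [stepProb, ne_eq, ENNReal.tsum_eq_zero, not_forall]
    exact ⟨y, by simpa [Leads] using h⟩
  | tail _ h ih =>
    obtain ⟨k, hk, hk'⟩ := ih
    refine ⟨k + 1, by omega, ?_⟩
    simp only [stepProb, ne_eq, ENNReal.tsum_eq_zero, not_forall]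
    exact ⟨_, mul_ne_zero hk' h⟩

variable [MeasurableSpace Ω] [MeasurableSpace S] {μ : Measure Ω}

lemma measure_eq_tsum_inter_preimage {β : Type*} [Countable β] [MeasurableSpace β]
    [MeasurableSingletonClass β] (μ : Measure Ω) {f : Ω → β} (hf : Measurable f) (E : Set Ω) :
    μ E = ∑' b, μ (E ∩ f ⁻¹' {b}) := by
  have h := tsum_measure_preimage_singleton (μ := μ.restrict E) (s := Set.univ) Set.countable_univ
    (f := f) fun y _ => hf (measurableSet_singleton y)
  rw [tsum_univ (fun b => μ.restrict E (f ⁻¹' {b}))] at h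
  rw [Set.preimage_univ, Measure.restrict_apply_univ] at h
  rw [← h]
  refine tsum_congr fun b => ?_
  rw [Measure.restrict_apply (hf (measurableSet_singleton b)), Set.inter_comm]

variable [MeasurableSingletonClass S]

lemma IsMarkovChain.measurableSet_notReturned (hX : IsMarkovChain μ P x X) (n : ℕ) :
    MeasurableSet (notReturned X x n) := by
  have : notReturned X x n = ⋂ k, ⋂ (_ : 1 ≤ k), ⋂ (_ : k ≤ n), (X k ⁻¹' {x})ᶜ := by
    ext ω; simp [notReturned]
  rw [this]
  exact .iInter fun k => .iInter fun _ => .iInter fun _ =>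
    (hX.measurable k (measurableSet_singleton x)).compl

lemma IsMarkovChain.lintegral_returnTime_le (hX : IsMarkovChain μ P x X) :
    ∫⁻ ω, returnTime X x ω ∂μ ≤ ∑' n, μ (notReturned X x n) := by
  refine (lintegral_mono (returnTime_le_tsum_indicator X x)).trans (le_of_eq ?_)
  rw [lintegral_tsum fun n =>
    (measurable_one.indicator (hX.measurableSet_notReturned n)).aemeasurable]
  exact tsum_congr fun n => lintegral_indicator_one (hX.measurableSet_notReturned n)

variable [Countable S]

/-- The Markov property, conditionally on any event of the past: such an event is a countable
union of the cylinders that occur in the definition. -/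
lemma IsMarkovChain.measure_inter_succ (hX : IsMarkovChain μ P x X) {n : ℕ} {A : Set Ω}
    (hA : DeterminedBy X n A) (y z : S) :
    μ (A ∩ {ω | X n ω = y} ∩ {ω | X (n + 1) ω = z}) = μ (A ∩ {ω | X n ω = y}) * P y z := by
  have hm : Measurable fun ω (k : Fin (n + 1)) => X k ω :=
    measurable_pi_lambda _ fun k => hX.measurable k
  rw [measure_eq_tsum_inter_preimage μ hm (A ∩ {ω | X n ω = y} ∩ {ω | X (n + 1) ω = z}),
    measure_eq_tsum_inter_preimage μ hm (A ∩ {ω | X n ω = y}), ← ENNReal.tsum_mul_right]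
  refine tsum_congr fun h => ?_
  by_cases hne : (A ∩ {ω | X n ω = y} ∩ (fun ω (k : Fin (n + 1)) => X k ω) ⁻¹' {h}).Nonempty
  · obtain ⟨ω₀, ⟨h1, h2⟩, h3⟩ := hne
    have hk : ∀ (k : ℕ) (hkn : k ≤ n), X k ω₀ = h ⟨k, by omega⟩ := fun k hk =>
      congrFun (show (fun k : Fin (n + 1) => X k ω₀) = h from h3) ⟨k, by omega⟩
    have hk' : ∀ ω, (fun k : Fin (n + 1) => X k ω) = h ↔ ∀ k ≤ n, X k ω = X k ω₀ := by
      intro ω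
      constructor
      · rintro hω k hkn
        rw [hk k hkn, ← hω]
      · intro hω
        funext k
        rw [hω k (by have := k.2; omega), hk k (by have := k.2; omega)]
    have h2' : X n ω₀ = y := h2
    -- A nonempty piece of the partition by the values of `X 0, …, X n` is a cylinder.
    have key := hX.markov n (fun k => if k ≤ n then X k ω₀ else z)
    have e1 : {ω | ∀ k ≤ n + 1, X k ω = if k ≤ n then X k ω₀ else z} =
        A ∩ {ω | X n ω = y} ∩ {ω | X (n + 1) ω = z} ∩
          (fun ω (k : Fin (n + 1)) => X k ω) ⁻¹' {h} := by
      ext ω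
      simp only [Set.mem_ofPred_eq, Set.mem_inter_iff, Set.mem_preimage, Set.mem_singleton_iff, hk']
      constructor
      · intro H
        have H' : ∀ k ≤ n, X k ω = X k ω₀ := fun k hkn => by
          have := H k (by omega); rwa [if_pos hkn] at this
        have Hz := H (n + 1) le_rfl
        rw [if_neg (by omega)] at Hz
        exact ⟨⟨⟨hA ω₀ ω (fun k hkn => (H' k hkn).symm) h1, (H' n le_rfl).trans h2'⟩, Hz⟩, H'⟩
      · rintro ⟨⟨_, Hz⟩, H'⟩ k hkn
        split_ifs with hkn'
        · exact H' k hkn'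
        · rw [show k = n + 1 by omega]; exact Hz
    have e2 : {ω | ∀ k ≤ n, X k ω = if k ≤ n then X k ω₀ else z} =
        A ∩ {ω | X n ω = y} ∩ (fun ω (k : Fin (n + 1)) => X k ω) ⁻¹' {h} := by
      ext ω
      simp only [Set.mem_ofPred_eq, Set.mem_inter_iff, Set.mem_preimage, Set.mem_singleton_iff, hk']
      constructor
      · intro H
        have H' : ∀ k ≤ n, X k ω = X k ω₀ := fun k hkn => by
          have := H k hkn; rwa [if_pos hkn] at this
        exact ⟨⟨hA ω₀ ω (fun k hkn => (H' k hkn).symm) h1, (H' n le_rfl).trans h2'⟩, H'⟩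
      · rintro ⟨_, H'⟩ k hkn
        rw [if_pos hkn]; exact H' k hkn
    rw [e1, e2, if_pos le_rfl, if_neg (by omega), h2'] at key
    exact key
  · rw [Set.not_nonempty_iff_eq_empty] at hne
    rw [Set.inter_right_comm, hne]
    simp

lemma IsMarkovChain.measure_inter_add (hX : IsMarkovChain μ P x X) {n : ℕ} {A : Set Ω}
    (hA : DeterminedBy X n A) (y : S) (k : ℕ) (z : S) :
    μ (A ∩ {ω | X n ω = y} ∩ {ω | X (n + k) ω = z}) =
      μ (A ∩ {ω | X n ω = y}) * stepProb P k y z := by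
  induction k generalizing z with
  | zero =>
    by_cases h : z = y
    · subst h
      rw [add_zero, Set.inter_assoc, Set.inter_self]; simp [stepProb]
    · have : A ∩ {ω | X n ω = y} ∩ {ω | X (n + 0) ω = z} = ∅ := by
        ext ω; simp only [Set.mem_inter_iff, Set.mem_ofPred_eq, add_zero, Set.mem_empty_iff_false,
          iff_false]
        rintro ⟨⟨_, h1⟩, h2⟩
        exact h (h2.symm.trans h1)
      rw [this]; simp [stepProb, h]
  | succ k ih =>
    rw [measure_eq_tsum_inter_preimage μ (hX.measurable (n + k))]
    simp only [stepProb]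
    rw [← ENNReal.tsum_mul_left]
    refine tsum_congr fun u => ?_
    rw [← mul_assoc, ← ih u, ← hX.measure_inter_succ (n := n + k) (A := A ∩ {ω | X n ω = y})
      ((hA.inter (determinedBy_eq n y)).mono (by omega)) u z, Set.inter_right_comm]
    rfl

/-- If `x` is accessible from `y`, then the expected number of visits to `y` before the first
return to `x` is finite: at each visit there is a chance `δ > 0`, the same at all visits, that `x`
is hit within `k` steps, so that `δ` times the number of visits in `[0, N)` is bounded by a
telescoping sum. -/
lemma IsMarkovChain.tsum_visits_lt_top [IsProbabilityMeasure μ] (hX : IsMarkovChain μ P x X)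
    {y : S} {k : ℕ} (hk : 1 ≤ k) (h : stepProb P k y x ≠ 0) :
    ∑' n, μ (notReturned X x n ∩ {ω | X n ω = y}) < ∞ := by
  set δ := stepProb P k y x with hδ
  have hvisit : ∀ n, δ * μ (notReturned X x n ∩ {ω | X n ω = y}) + μ (notReturned X x (n + k)) ≤
      μ (notReturned X x n) := by
    intro n
    rw [mul_comm, ← hX.measure_inter_add (determinedBy_notReturned n) y k x,
      ← measure_union _ (hX.measurableSet_notReturned _)]
    · refine measure_mono (Set.union_subset ?_ (notReturned_anti (by omega)))
      exact fun ω hω => hω.1.1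
    · rw [Set.disjoint_left]
      exact fun ω hω hω' => hω' (n + k) (by omega) le_rfl hω.2
  have fin : ∀ m, μ (notReturned X x m) ≠ ∞ := fun m => measure_ne_top _ _
  have bound : ∀ N, δ * ∑ n ∈ Finset.range N, μ (notReturned X x n ∩ {ω | X n ω = y}) ≤ k := by
    intro N
    have h1 := Finset.sum_le_sum (s := Finset.range N) fun n _ => hvisit n
    rw [Finset.sum_add_distrib, ← Finset.mul_sum] at h1
    have h2 : ∑ n ∈ Finset.range N, μ (notReturned X x n) ≤
        k + ∑ n ∈ Finset.range N, μ (notReturned X x (n + k)) := by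
      calc ∑ n ∈ Finset.range N, μ (notReturned X x n)
          ≤ ∑ n ∈ Finset.range (k + N), μ (notReturned X x n) :=
            Finset.sum_le_sum_of_subset (Finset.range_mono (by omega))
        _ = ∑ n ∈ Finset.range k, μ (notReturned X x n) +
              ∑ n ∈ Finset.range N, μ (notReturned X x (k + n)) := Finset.sum_range_add _ _ _
        _ ≤ k + ∑ n ∈ Finset.range N, μ (notReturned X x (n + k)) := by
            gcongr
            · refine (Finset.sum_le_card_nsmul _ _ 1 fun _ _ => prob_le_one).trans ?_
              simp
            · rw [add_comm]
    have h3 := h1.trans h2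
    exact (ENNReal.add_le_add_iff_right (ENNReal.sum_ne_top.2 fun n _ => fin _)).1 h3
  have bound' : ∑' n, μ (notReturned X x n ∩ {ω | X n ω = y}) ≤ k / δ := by
    refine ENNReal.tsum_le_of_sum_range_le fun N => ?_
    rw [ENNReal.le_div_iff_mul_le (Or.inl h) (Or.inr (by simp)), mul_comm]
    exact bound N
  exact bound'.trans_lt (ENNReal.div_lt_top (by simp) h)

lemma IsMarkovChain.exists_measure_pos [IsProbabilityMeasure μ] (hX : IsMarkovChain μ P x X)
    {y : S} (h : Relation.TransGen (Leads P) x y) : ∃ n, 0 < μ {ω | X n ω = y} := by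
  obtain ⟨k, -, hk⟩ := exists_stepProb_ne_zero h
  refine ⟨k, ?_⟩
  have := hX.measure_inter_add (n := 0) (A := Set.univ) (fun _ _ _ h => h) x k y
  simp only [hX.start, Set.ofPred_true, Set.univ_inter, measure_univ, one_mul, zero_add] at this
  rw [this]
  exact pos_iff_ne_zero.2 hk

/-- **Foster's criterion**: a chain has a finite mean return time to a state that is accessible from
everywhere, if some function `V` decreases by at least `1` on average in each step that starts
outside a finite set `F`. The mean of `V` before the return to `x` decreases by the probability
that the return is still to come, and increases only through visits to `F`, of which there are
finitely many on average. -/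
theorem IsMarkovChain.lintegral_returnTime_lt_top [IsProbabilityMeasure μ]
    (hX : IsMarkovChain μ P x X) (hreach : ∀ y, Relation.TransGen (Leads P) y x)
    (V : S → ℝ≥0∞) (hVx : V x ≠ ∞) (F : Finset S)
    (hdrift : ∀ y ∉ F, ∑' z, P y z * V z + 1 ≤ V y) (hfin : ∀ y ∈ F, ∑' z, P y z * V z ≠ ∞) :
    ∫⁻ ω, returnTime X x ω ∂μ < ∞ := by
  classical
  refine hX.lintegral_returnTime_le.trans_lt ?_
  set b : ℕ → ℝ≥0∞ := fun n => μ (notReturned X x n) with hb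
  set f : ℕ → S → ℝ≥0∞ := fun n y => μ (notReturned X x n ∩ {ω | X n ω = y}) with hf
  -- A bound for the mean increase of `V` in a step that starts in `F`.
  set K : ℝ≥0∞ := ∑ y ∈ F, (∑' z, P y z * V z + 1) with hK
  have hKtop : K ≠ ∞ := ENNReal.sum_ne_top.2 fun y hy => by simpa using hfin y hy
  have hdrift' : ∀ y, ∑' z, P y z * V z + 1 ≤ V y + if y ∈ F then K else 0 := by
    intro y
    split_ifs with hy
    · exact (Finset.single_le_sum (f := fun y => ∑' z, P y z * V z + 1)
        (fun _ _ => zero_le) hy).trans le_add_self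
    · simpa using hdrift y hy
  have hbf : ∀ n, b n = ∑' y, f n y := fun n =>
    measure_eq_tsum_inter_preimage μ (hX.measurable n) _
  have hstep : ∀ n z, f (n + 1) z ≤ ∑' y, f n y * P y z := by
    intro n z
    calc f (n + 1) z ≤ μ (notReturned X x n ∩ {ω | X (n + 1) ω = z}) :=
          measure_mono (Set.inter_subset_inter_left _ (notReturned_anti (by omega)))
      _ = ∑' y, f n y * P y z := by
          rw [measure_eq_tsum_inter_preimage μ (hX.measurable n)]
          refine tsum_congr fun y => ?_
          rw [hf, ← hX.measure_inter_succ (determinedBy_notReturned n) y z, Set.inter_right_comm]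
          rfl
  set a : ℕ → ℝ≥0∞ := fun n => ∑' y, f n y * V y with ha
  have ha_succ : ∀ n, a (n + 1) + b n ≤ a n + K * ∑ y ∈ F, f n y := by
    intro n
    calc a (n + 1) + b n ≤ ∑' z, (∑' y, f n y * P y z) * V z + ∑' y, f n y := by
          rw [hbf]
          exact add_le_add (ENNReal.tsum_le_tsum fun z => mul_le_mul_left (hstep n z) _) le_rfl
      _ = ∑' y, f n y * (∑' z, P y z * V z + 1) := by
          simp_rw [mul_add, mul_one, ← ENNReal.tsum_mul_left, ← ENNReal.tsum_mul_right]
          rw [ENNReal.tsum_add, ENNReal.tsum_comm]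
          simp_rw [mul_assoc]
      _ ≤ ∑' y, f n y * (V y + if y ∈ F then K else 0) := by
          exact ENNReal.tsum_le_tsum fun y => mul_le_mul_right (hdrift' y) _
      _ = a n + K * ∑ y ∈ F, f n y := by
          simp_rw [mul_add]
          rw [ENNReal.tsum_add, tsum_eq_sum (s := F) (f := fun y => f n y * if y ∈ F then K else 0)
            (fun y hy => by simp [hy]), Finset.mul_sum]
          congr 1
          exact Finset.sum_congr rfl fun y hy => by rw [if_pos hy, mul_comm]
  have ha_zero : a 0 = V x := by
    rw [ha]
    simp only
    rw [tsum_eq_single x]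
    · have : notReturned X x 0 ∩ {ω | X 0 ω = x} = Set.univ := by
        ext ω
        simp only [notReturned, Set.mem_inter_iff, Set.mem_ofPred_eq, hX.start, and_true,
          Set.mem_univ, iff_true]
        intro k hk hk'; omega
      simp [hf, this]
    · intro y hy
      have : notReturned X x 0 ∩ {ω | X 0 ω = y} = ∅ := by
        ext ω
        simp [hX.start, hy.symm]
      simp [hf, this]
  have htel : ∀ N, a N + ∑ n ∈ Finset.range N, b n ≤
      V x + K * ∑ n ∈ Finset.range N, ∑ y ∈ F, f n y := by
    intro N
    induction N with
    | zero => simp [ha_zero]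
    | succ N ih =>
      rw [Finset.sum_range_succ, Finset.sum_range_succ, mul_add, ← add_assoc]
      calc a (N + 1) + ∑ n ∈ Finset.range N, b n + b N
          = (a (N + 1) + b N) + ∑ n ∈ Finset.range N, b n := by ring
        _ ≤ (a N + K * ∑ y ∈ F, f N y) + ∑ n ∈ Finset.range N, b n :=
            add_le_add_left (ha_succ N) _
        _ = (a N + ∑ n ∈ Finset.range N, b n) + K * ∑ y ∈ F, f N y := by ring
        _ ≤ _ := add_le_add_left ih _
        _ = _ := by ring
  have hvisits : ∑ y ∈ F, ∑' n, f n y ≠ ∞ := ENNReal.sum_ne_top.2 fun y _ => by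
    obtain ⟨k, hk, hk'⟩ := exists_stepProb_ne_zero (hreach y)
    exact (hX.tsum_visits_lt_top hk hk').ne
  have hfinal : ∑' n, b n ≤ V x + K * ∑ y ∈ F, ∑' n, f n y := by
    refine ENNReal.tsum_le_of_sum_range_le fun N => (le_add_self.trans (htel N)).trans ?_
    rw [Finset.sum_comm]
    gcongr with y
    exact ENNReal.sum_le_tsum _
  exact hfinal.trans_lt (ENNReal.add_lt_top.2 ⟨hVx.lt_top, ENNReal.mul_lt_top hKtop.lt_top
    hvisits.lt_top⟩)

end Foster

/-! ### The arrival paths and their law -/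

/-- The space of joint arrival paths at the two nodes: nondecreasing right-continuous functions of
time with values in `ℕ × ℕ` that start at `(0, 0)`. As a subtype of the space of all functions, it
carries the σ-algebra generated by the evaluations. -/
abbrev ArrivalPath : Type :=
  {p : ℝ≥0 → ℕ × ℕ // p 0 = 0 ∧ Monotone p ∧ ∀ t, ContinuousWithinAt p (Set.Ici t) t}

namespace ArrivalPath

lemma zero (p : ArrivalPath) : p.1 0 = 0 := p.2.1

lemma monotone (p : ArrivalPath) : Monotone p.1 := p.2.2.1

lemma measurable_eval (t : ℝ≥0) : Measurable fun p : ArrivalPath => p.1 t :=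
  (measurable_pi_apply t).comp measurable_subtype_coe

/-- Along times that converge from the right, a path is eventually constant. -/
lemma eventually_eq (p : ArrivalPath) {t : ℝ≥0} {u : ℕ → ℝ≥0} (hu : ∀ k, t ≤ u k)
    (hlim : Tendsto u atTop (𝓝 t)) : ∀ᶠ k in atTop, p.1 (u k) = p.1 t := by
  have h : Tendsto (fun k => p.1 (u k)) atTop (𝓝 (p.1 t)) :=
    (p.2.2.2 t).tendsto.comp (tendsto_nhdsWithin_iff.2 ⟨hlim, .of_forall hu⟩)
  rwa [nhds_discrete, tendsto_pure] at h

/-- The first point of the grid `ℕ / (k + 1)` that is not before `t`. -/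
def gridCeil (k : ℕ) (t : ℝ≥0) : ℝ≥0 := (⌈t * (k + 1)⌉₊ : ℝ≥0) / (k + 1)

lemma le_gridCeil (k : ℕ) (t : ℝ≥0) : t ≤ gridCeil k t := by
  rw [gridCeil, le_div_iff₀ (by positivity)]
  exact Nat.le_ceil _

lemma gridCeil_le (k : ℕ) (t : ℝ≥0) : gridCeil k t ≤ t + 1 / (k + 1) := by
  rw [gridCeil, div_le_iff₀ (by positivity), add_mul, one_div, inv_mul_cancel₀ (by positivity)]
  exact (Nat.ceil_lt_add_one (by positivity)).le

lemma tendsto_inv_nat_succ : Tendsto (fun k : ℕ => 1 / ((k : ℝ≥0) + 1)) atTop (𝓝 0) := by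
  rw [← NNReal.tendsto_coe]
  simpa using tendsto_one_div_add_atTop_nhds_zero_nat (𝕜 := ℝ)

lemma tendsto_gridCeil (t : ℝ≥0) : Tendsto (fun k => gridCeil k t) atTop (𝓝 t) := by
  refine tendsto_of_tendsto_of_tendsto_of_le_of_le tendsto_const_nhds ?_
    (fun k => le_gridCeil k t) (fun k => gridCeil_le k t)
  simpa using tendsto_inv_nat_succ.const_add t

/-- The evaluation is jointly measurable, as a limit of evaluations at countably many times. -/
lemma measurable_eval_uncurry : Measurable fun x : ℝ≥0 × ArrivalPath => x.2.1 x.1 := by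
  refine measurable_of_tendsto_metrizable
    (f := fun k (x : ℝ≥0 × ArrivalPath) => x.2.1 (gridCeil k x.1)) (fun k => ?_) ?_
  · have h1 : Measurable fun y : ℕ × ArrivalPath => y.2.1 ((y.1 : ℝ≥0) / (k + 1)) :=
      measurable_from_prod_countable_right fun n => measurable_eval ((n : ℝ≥0) / (k + 1))
    have h2 : Measurable fun x : ℝ≥0 × ArrivalPath => (⌈x.1 * (k + 1)⌉₊, x.2) := by fun_prop
    exact h1.comp h2
  · refine tendsto_pi_nhds.2 fun x => ?_
    exact tendsto_nhds_of_eventually_eq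
      (x.2.eventually_eq (fun k => le_gridCeil k x.1) (tendsto_gridCeil x.1))

/-- The path of the arrivals after the time `s`. -/
def shift (s : ℝ≥0) (p : ArrivalPath) : ArrivalPath :=
  ⟨fun u => p.1 (s + u) - p.1 s, by simp,
    fun _ _ h => tsub_le_tsub_right (p.monotone (add_le_add_right h s)) _, fun t => by
      have h1 : ContinuousWithinAt (fun u => p.1 (s + u)) (Set.Ici t) t :=
        (p.2.2.2 (s + t)).comp (t := Set.Ici (s + t)) (by fun_prop)
          fun u hu => add_le_add_right (Set.mem_Ici.1 hu) s
      exact (continuous_of_discreteTopology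
        (f := fun x : ℕ × ℕ => x - p.1 s)).continuousAt.comp_continuousWithinAt h1⟩

lemma shift_apply (s u : ℝ≥0) (p : ArrivalPath) : (shift s p).1 u = p.1 (s + u) - p.1 s := rfl

lemma add_shift_apply (s u : ℝ≥0) (p : ArrivalPath) : p.1 s + (shift s p).1 u = p.1 (s + u) := by
  have h := p.monotone (show s ≤ s + u from le_self_add)
  rw [shift_apply]
  exact Prod.ext (Nat.add_sub_cancel' h.1) (Nat.add_sub_cancel' h.2)

lemma shift_zero (p : ArrivalPath) : shift 0 p = p :=
  Subtype.ext (funext fun u => by rw [shift_apply, zero_add, p.zero, tsub_zero])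

lemma shift_shift (s t : ℝ≥0) (p : ArrivalPath) : shift t (shift s p) = shift (s + t) p := by
  refine Subtype.ext (funext fun u => ?_)
  have h := p.monotone (show s ≤ s + t from le_self_add)
  simp only [shift_apply, add_assoc]
  refine Prod.ext ?_ ?_ <;> simp only [Prod.fst_sub, Prod.snd_sub]
  · have := h.1; omega
  · have := h.2; omega

lemma measurable_shift_uncurry : Measurable fun x : ℝ≥0 × ArrivalPath => shift x.1 x.2 := by
  refine Measurable.subtype_mk (measurable_pi_lambda _ fun u => ?_)
  have h1 : Measurable fun x : ℝ≥0 × ArrivalPath => x.2.1 (x.1 + u) :=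
    measurable_eval_uncurry.comp (f := fun x : ℝ≥0 × ArrivalPath => (x.1 + u, x.2)) (by fun_prop)
  exact (measurable_of_countable fun y : (ℕ × ℕ) × (ℕ × ℕ) => y.1 - y.2).comp
    (h1.prodMk measurable_eval_uncurry)

lemma measurable_shift (s : ℝ≥0) : Measurable (shift s) :=
  measurable_shift_uncurry.comp measurable_prodMk_left

/-- The set of the paths that pass through the points `(t k, c k)`, `k ≤ n`. -/
def pathCylinder (t : ℕ → ℝ≥0) (c : ℕ → ℕ × ℕ) (n : ℕ) : Set ArrivalPath :=
  {p | ∀ k ≤ n, p.1 (t k) = c k}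

lemma measurableSet_pathCylinder (t : ℕ → ℝ≥0) (c : ℕ → ℕ × ℕ) (n : ℕ) :
    MeasurableSet (pathCylinder t c n) := by
  have : pathCylinder t c n = ⋂ k, ⋂ (_ : k ≤ n), (fun p : ArrivalPath => p.1 (t k)) ⁻¹' {c k} := by
    ext p; simp [pathCylinder]
  rw [this]
  exact .iInter fun k => .iInter fun _ => measurable_eval _ (measurableSet_singleton _)

/-- A finite set of times can be listed in increasing order, starting at `0`. -/
lemma exists_monotone_enumeration (I : Finset ℝ≥0) : ∃ (t : ℕ → ℝ≥0) (n : ℕ),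
    Monotone t ∧ t 0 = 0 ∧ (∀ k ≤ n, t k ∈ insert 0 I) ∧ ∀ i ∈ I, ∃ k ≤ n, t k = i := by
  classical
  induction I using Finset.induction_on_max with
  | empty => exact ⟨fun _ => 0, 0, monotone_const, rfl, by simp, by simp⟩
  | insert a s ha ih =>
    obtain ⟨t, n, ht, ht0, hmem, hI⟩ := ih
    have hle : ∀ k ≤ n, t k ≤ a := fun k hk => by
      rcases Finset.mem_insert.1 (hmem k hk) with h | h
      · rw [h]; exact zero_le
      · exact (ha _ h).le
    refine ⟨fun k => if k ≤ n then t k else a, n + 1, ?_, by simp [ht0], ?_, ?_⟩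
    · intro i j hij
      simp only
      split_ifs with h1 h2 h2
      · exact ht hij
      · exact hle i h1
      · omega
      · exact le_rfl
    · intro k hk
      simp only
      split_ifs with h1
      · have := hmem k h1
        rw [Finset.mem_insert] at this ⊢
        exact this.imp id (Finset.mem_insert_of_mem)
      · simp
    · intro i hi
      rcases Finset.mem_insert.1 hi with rfl | hi
      · exact ⟨n + 1, le_rfl, by simp⟩
      · obtain ⟨k, hk, rfl⟩ := hI i hi
        exact ⟨k, by omega, by simp [hk]⟩

/-- A finite measure on the path space is determined by its values on the cylinders with increasing
times `0 = t 0 ≤ t 1 ≤ …` and increasing counts `0 = c 0 ≤ c 1 ≤ …`. -/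
theorem ext_of_pathCylinder {μ ν : Measure ArrivalPath} [IsFiniteMeasure μ]
    (h : ∀ (t : ℕ → ℝ≥0) (c : ℕ → ℕ × ℕ) (n : ℕ), Monotone t → t 0 = 0 → Monotone c → c 0 = 0 →
      μ (pathCylinder t c n) = ν (pathCylinder t c n)) : μ = ν := by
  -- The cylinders over all finite sets of times are a π-system that generates the σ-algebra; a
  -- nonempty one is of the required form, with the values of one of its own paths as counts.
  let C : Set (Set ArrivalPath) :=
    {A | ∃ (I : Finset ℝ≥0) (c : ℝ≥0 → ℕ × ℕ), A = {p : ArrivalPath | ∀ i ∈ I, p.1 i = c i}}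
  have key : ∀ A ∈ C, μ A = ν A := by
    rintro A ⟨I, c, rfl⟩
    rcases Set.eq_empty_or_nonempty {p : ArrivalPath | ∀ i ∈ I, p.1 i = c i} with hA | ⟨p, hp⟩
    · rw [hA]; simp
    · obtain ⟨t, n, ht, ht0, hmem, hI⟩ := exists_monotone_enumeration I
      have e : {p : ArrivalPath | ∀ i ∈ I, p.1 i = c i} =
          pathCylinder t (fun k => p.1 (t k)) n := by
        ext q
        constructor
        · intro hq k hk
          rcases Finset.mem_insert.1 (hmem k hk) with h0 | h1
          · simp only [h0, p.zero, q.zero]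
          · exact (hq _ h1).trans (hp _ h1).symm
        · intro hq i hi
          obtain ⟨k, hk, rfl⟩ := hI i hi
          exact (hq k hk).trans (hp _ hi)
      rw [e]
      exact h t _ n ht ht0 (p.monotone.comp ht) (by simp only [ht0, p.zero])
  have hgen : (inferInstance : MeasurableSpace ArrivalPath) = MeasurableSpace.generateFrom C := by
    apply le_antisymm
    · have : Measurable[MeasurableSpace.generateFrom C] (fun p : ArrivalPath => p.1) := by
        refine @measurable_pi_lambda _ _ _ (MeasurableSpace.generateFrom C) _ _ fun i => ?_
        refine @measurable_to_countable' _ _ _ _ (MeasurableSpace.generateFrom C) _ fun v => ?_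
        refine MeasurableSpace.measurableSet_generateFrom ⟨{i}, fun _ => v, ?_⟩
        ext p; simp
      exact this.comap_le
    · refine MeasurableSpace.generateFrom_le ?_
      rintro A ⟨I, c, rfl⟩
      have : {p : ArrivalPath | ∀ i ∈ I, p.1 i = c i} =
          ⋂ i ∈ I, (fun p : ArrivalPath => p.1 i) ⁻¹' {c i} := by
        ext p; simp
      rw [this]
      exact Finset.measurableSet_biInter _ fun i _ => measurable_eval _ (measurableSet_singleton _)
  have hpi : IsPiSystem C := by
    rintro A ⟨I, c, rfl⟩ B ⟨J, d, rfl⟩ ⟨p, hp1, hp2⟩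
    classical
    refine ⟨I ∪ J, p.1, ?_⟩
    ext q
    simp only [Set.mem_inter_iff, Set.mem_ofPred_eq, Finset.mem_union]
    constructor
    · rintro ⟨h1, h2⟩ i (hi | hi)
      · rw [h1 i hi, hp1 i hi]
      · rw [h2 i hi, hp2 i hi]
    · intro hq
      exact ⟨fun i hi => by rw [hq i (Or.inl hi), hp1 i hi],
        fun i hi => by rw [hq i (Or.inr hi), hp2 i hi]⟩
  refine ext_of_generate_finite C hgen hpi key ?_
  exact key Set.univ ⟨∅, fun _ => 0, by simp⟩

end ArrivalPath

open ArrivalPath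

/-- `ν` is the joint law of two independent Poisson processes of the rates `rA` and `rB`, given by
its values on cylinders. -/
def IsPoissonLaw (rA rB : ℝ≥0) (ν : Measure ArrivalPath) : Prop :=
  ∀ (t : ℕ → ℝ≥0) (c : ℕ → ℕ × ℕ) (n : ℕ), Monotone t → t 0 = 0 → Monotone c → c 0 = 0 →
    ν (pathCylinder t c n) = ∏ k ∈ Finset.range n,
      (poissonMeasure (rA * (t (k + 1) - t k)) {(c (k + 1)).1 - (c k).1} *
        poissonMeasure (rB * (t (k + 1) - t k)) {(c (k + 1)).2 - (c k).2})

section Law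

variable {Ω : Type*} [MeasurableSpace Ω] {μ : Measure Ω} {NA NB : ℝ≥0 → Ω → ℕ} {rA rB : ℝ≥0}

lemma IsPoissonProcess.measure_increments {N : ℝ≥0 → Ω → ℕ} {r : ℝ≥0} (hN : IsPoissonProcess N r μ)
    {t : ℕ → ℝ≥0} (ht : Monotone t) (d : ℕ → ℕ) (n : ℕ) :
    μ {ω | ∀ k < n, N (t (k + 1)) ω - N (t k) ω = d k} =
      ∏ k ∈ Finset.range n, poissonMeasure (r * (t (k + 1) - t k)) {d k} := by
  have h := (hN.indep.nat ht).measure_inter_preimage_eq_mul (Finset.range n)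
    (sets := fun k => {d k}) fun _ _ => measurableSet_singleton _
  have e : {ω | ∀ k < n, N (t (k + 1)) ω - N (t k) ω = d k} =
      ⋂ i ∈ Finset.range n, (fun ω => N (t (i + 1)) ω - N (t i) ω) ⁻¹' {d i} := by
    ext ω; simp
  rw [e, h]
  refine Finset.prod_congr rfl fun k _ => ?_
  have hm : Measurable fun ω => N (t (k + 1)) ω - N (t k) ω :=
    (hN.measurable _).sub (hN.measurable _)
  rw [← hN.law _ _ (ht k.le_succ), Measure.map_apply hm (measurableSet_singleton _)]

/-- The joint arrival path of two counting processes. -/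
def arrivals (hA : IsPoissonProcess NA rA μ) (hB : IsPoissonProcess NB rB μ) (ω : Ω) :
    ArrivalPath :=
  ⟨fun t => (NA t ω, NB t ω), Prod.ext (hA.zero ω) (hB.zero ω),
    fun _ _ h => ⟨hA.mono ω h, hB.mono ω h⟩,
    fun t => (hA.rightCont ω t).prodMk (hB.rightCont ω t)⟩

lemma measurable_arrivals (hA : IsPoissonProcess NA rA μ) (hB : IsPoissonProcess NB rB μ) :
    Measurable (arrivals hA hB) :=
  Measurable.subtype_mk (measurable_pi_lambda _ fun t => (hA.measurable t).prodMk (hB.measurable t))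

lemma forall_eq_iff_increments {f c : ℕ → ℕ} (hf : Monotone f) (hc : Monotone c)
    (h0 : f 0 = c 0) (n : ℕ) :
    (∀ k ≤ n, f k = c k) ↔ ∀ k < n, f (k + 1) - f k = c (k + 1) - c k := by
  constructor
  · intro h k hk
    rw [h k hk.le, h (k + 1) hk]
  · intro h k
    induction k with
    | zero => exact fun _ => h0
    | succ k ih =>
      intro hk
      have h1 := ih (by omega)
      have h2 := h k hk
      have h3 := hf k.le_succ
      have h4 := hc k.le_succ
      simp only [Nat.succ_eq_add_one] at h3 h4
      omega

theorem isPoissonLaw_map_arrivals (hA : IsPoissonProcess NA rA μ) (hB : IsPoissonProcess NB rB μ)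
    (hAB : IndepFun (fun ω t => NA t ω) (fun ω t => NB t ω) μ) :
    IsPoissonLaw rA rB (μ.map (arrivals hA hB)) := by
  intro t c n ht ht0 hc hc0
  rw [Measure.map_apply (measurable_arrivals hA hB) (measurableSet_pathCylinder t c n),
    Finset.prod_mul_distrib, ← hA.measure_increments ht, ← hB.measure_increments ht]
  have hm : ∀ d : ℕ → ℕ, MeasurableSet
      {p : ℝ≥0 → ℕ | ∀ k < n, p (t (k + 1)) - p (t k) = d k} := by
    intro d
    have : {p : ℝ≥0 → ℕ | ∀ k < n, p (t (k + 1)) - p (t k) = d k} =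
        ⋂ k, ⋂ (_ : k < n), (fun p => p (t (k + 1)) - p (t k)) ⁻¹' {d k} := by
      ext p; simp
    rw [this]
    refine .iInter fun k => .iInter fun _ => ?_
    have h : Measurable fun p : ℝ≥0 → ℕ => p (t (k + 1)) - p (t k) :=
      (measurable_pi_apply _).sub (measurable_pi_apply _)
    exact h (measurableSet_singleton _)
  have h := hAB.measure_inter_preimage_eq_mul _ _ (hm fun k => (c (k + 1)).1 - (c k).1)
    (hm fun k => (c (k + 1)).2 - (c k).2)
  refine Eq.trans (congrArg μ ?_) h
  ext ω
  have hcA : Monotone fun k => (c k).1 := fun _ _ h => (hc h).1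
  have hcB : Monotone fun k => (c k).2 := fun _ _ h => (hc h).2
  have h1 := forall_eq_iff_increments (f := fun k => NA (t k) ω) ((hA.mono ω).comp ht) hcA
    (by simp [ht0, hA.zero ω, hc0]) n
  have h2 := forall_eq_iff_increments (f := fun k => NB (t k) ω) ((hB.mono ω).comp ht) hcB
    (by simp [ht0, hB.zero ω, hc0]) n
  simp only [Set.mem_inter_iff, Set.mem_preimage, Set.mem_ofPred_eq, ← h1, ← h2, pathCylinder,
    arrivals]
  exact ⟨fun h => ⟨fun k hk => congrArg Prod.fst (h k hk), fun k hk => congrArg Prod.snd (h k hk)⟩,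
    fun h k hk => Prod.ext (h.1 k hk) (h.2 k hk)⟩

end Law

/-! ### The Markov property at fixed times -/

section WeakMarkov

variable {rA rB : ℝ≥0} {ν : Measure ArrivalPath}

lemma IsPoissonLaw.measure_eval (hν : IsPoissonLaw rA rB ν) (s : ℝ≥0) (v : ℕ × ℕ) :
    ν {p | p.1 s = v} = poissonMeasure (rA * s) {v.1} * poissonMeasure (rB * s) {v.2} := by
  have h := hν (fun k => if k = 0 then 0 else s) (fun k => if k = 0 then 0 else v) 1
    (by intro i j hij; simp only; split_ifs <;> first | omega | simp)
    (by simp) (by intro i j hij; simp only; split_ifs <;> first | omega | simp) (by simp)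
  simp only [Finset.range_one, Finset.prod_singleton] at h
  simp only [zero_add, one_ne_zero, if_true, if_false, tsub_zero, Prod.fst_zero, Prod.snd_zero] at h
  rw [← h]
  congr 1
  ext p
  simp only [pathCylinder, Set.mem_ofPred_eq]
  constructor
  · intro hp k hk
    split_ifs
    · exact p.zero
    · exact hp
  · intro hp
    simpa using hp 1 le_rfl

/-- The **Markov property** of the arrivals at a fixed time `s`: the arrivals after `s` are
independent of those up to `s`, with the same law as all arrivals. -/
theorem IsPoissonLaw.measure_eval_inter_shift [IsProbabilityMeasure ν] (hν : IsPoissonLaw rA rB ν)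
    (s : ℝ≥0) (v : ℕ × ℕ) {B : Set ArrivalPath} (hB : MeasurableSet B) :
    ν {p | p.1 s = v ∧ shift s p ∈ B} = ν {p | p.1 s = v} * ν B := by
  have hmv : MeasurableSet {p : ArrivalPath | p.1 s = v} :=
    measurable_eval s (measurableSet_singleton v)
  have key : (ν.restrict {p | p.1 s = v}).map (shift s) = ν {p | p.1 s = v} • ν := by
    refine ext_of_pathCylinder fun t c n ht ht0 hc hc0 => ?_
    rw [Measure.map_apply (measurable_shift s) (measurableSet_pathCylinder t c n),
      Measure.restrict_apply (measurable_shift s (measurableSet_pathCylinder t c n)),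
      Measure.smul_apply, smul_eq_mul, hν t c n ht ht0 hc hc0, hν.measure_eval]
    -- Times and counts of the cylinder that prescribes `v` at `s` and then the shifted cylinder.
    let U : ℕ → ℝ≥0 := fun k => if k = 0 then 0 else s + t (k - 1)
    let D : ℕ → ℕ × ℕ := fun k => if k = 0 then 0 else v + c (k - 1)
    have hU : Monotone U := by
      intro i j hij
      simp only [U]
      split_ifs
      · exact le_rfl
      · exact zero_le
      · omega
      · exact add_le_add_right (ht (by omega)) s
    have hD : Monotone D := by
      intro i j hij
      simp only [D]
      split_ifs
      · exact le_rfl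
      · exact zero_le
      · omega
      · exact add_le_add_right (hc (by omega)) v
    have e : shift s ⁻¹' pathCylinder t c n ∩ {p | p.1 s = v} = pathCylinder U D (n + 1) := by
      ext p
      simp only [pathCylinder, Set.mem_inter_iff, Set.mem_preimage, Set.mem_ofPred_eq]
      constructor
      · rintro ⟨h1, h2⟩ k hk
        simp only [U, D]
        split_ifs with h0
        · exact p.zero
        · rw [← add_shift_apply, h1 (k - 1) (by omega), h2]
      · intro h
        have h2 : p.1 s = v := by simpa [U, D, ht0, hc0] using h 1 (by omega)
        refine ⟨fun k hk => ?_, h2⟩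
        have h3 := h (k + 1) (by omega)
        simp only [U, D, Nat.add_eq_zero_iff, one_ne_zero, and_false, if_false,
          Nat.add_sub_cancel] at h3
        rw [← add_shift_apply, h2] at h3
        exact add_left_cancel h3
    rw [e, hν U D (n + 1) hU (by simp [U]) hD (by simp [D]), Finset.prod_range_succ', mul_comm]
    congr 1
    · simp [U, D, ht0, hc0]
    · refine Finset.prod_congr rfl fun k _ => ?_
      simp [U, D, add_tsub_add_eq_tsub_left]
  have h := congrArg (fun m => m B) key
  simp only [Measure.map_apply (measurable_shift s) hB,
    Measure.restrict_apply (measurable_shift s hB), Measure.smul_apply, smul_eq_mul] at h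
  rw [← h]
  congr 1
  ext p
  exact and_comm

end WeakMarkov

/-! ### The strong Markov property at the first arrival -/

namespace ArrivalPath

/-- There is at least one arrival. -/
def HasArrival (p : ArrivalPath) : Prop := ∃ u, p.1 u ≠ 0

/-- The time of the first arrival (the meaningless `0` if there is none). -/
def firstArrival (p : ArrivalPath) : ℝ≥0 := sInf {u | p.1 u ≠ 0}

lemma ne_zero_of_le {p : ArrivalPath} {s t : ℝ≥0} (h : s ≤ t) (hs : p.1 s ≠ 0) : p.1 t ≠ 0 :=
  fun ht => hs (le_antisymm ((p.monotone h).trans ht.le) zero_le)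

/-- The first arrival happens at a point of time, as paths are right-continuous. -/
lemma HasArrival.firstArrival_le_iff {p : ArrivalPath} (hp : p.HasArrival) {u : ℝ≥0} :
    p.firstArrival ≤ u ↔ p.1 u ≠ 0 := by
  refine ⟨fun h => ne_zero_of_le h fun h0 => ?_, fun h => csInf_le (OrderBot.bddBelow _) h⟩
  have hex : ∀ k : ℕ, ∃ u, p.1 u ≠ 0 ∧ u < p.firstArrival + 1 / ((k : ℝ≥0) + 1) := fun k =>
    exists_lt_of_csInf_lt (s := {u | p.1 u ≠ 0}) hp (lt_add_of_pos_right _ (by positivity))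
  choose w hw hw' using hex
  have hlim : Tendsto w atTop (𝓝 p.firstArrival) := by
    refine tendsto_of_tendsto_of_tendsto_of_le_of_le tendsto_const_nhds ?_
      (fun k => csInf_le (OrderBot.bddBelow _) (hw k)) (fun k => (hw' k).le)
    simpa using tendsto_inv_nat_succ.const_add p.firstArrival
  obtain ⟨k, hk⟩ := (p.eventually_eq (fun k => csInf_le (OrderBot.bddBelow _) (hw k)) hlim).exists
  exact hw k (hk.trans h0)

lemma hasArrival_iff_exists_nat {p : ArrivalPath} : p.HasArrival ↔ ∃ n : ℕ, p.1 n ≠ 0 := by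
  constructor
  · rintro ⟨u, hu⟩
    obtain ⟨n, hn⟩ := exists_nat_ge u
    exact ⟨n, ne_zero_of_le hn hu⟩
  · rintro ⟨n, hn⟩
    exact ⟨n, hn⟩

lemma measurableSet_hasArrival : MeasurableSet {p : ArrivalPath | p.HasArrival} := by
  simp_rw [hasArrival_iff_exists_nat, Set.ofPred_exists]
  exact .iUnion fun n => (measurable_eval n (measurableSet_singleton 0)).compl

lemma firstArrival_of_not_hasArrival {p : ArrivalPath} (hp : ¬ p.HasArrival) :
    p.firstArrival = 0 := by
  have : {u | p.1 u ≠ 0} = ∅ := Set.eq_empty_iff_forall_notMem.2 fun u hu => hp ⟨u, hu⟩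
  rw [firstArrival, this, NNReal.sInf_empty]

lemma measurable_firstArrival : Measurable firstArrival := by
  refine measurable_of_Iic fun t => ?_
  have : firstArrival ⁻¹' Set.Iic t = {p | p.HasArrival}ᶜ ∪ (fun p => p.1 t) ⁻¹' {0}ᶜ := by
    ext p
    by_cases hp : p.HasArrival
    · simp [hp, hp.firstArrival_le_iff]
    · simp [hp, firstArrival_of_not_hasArrival hp]
  rw [this]
  exact measurableSet_hasArrival.compl.union (measurable_eval t (measurableSet_singleton 0).compl)

lemma measurable_eval_comp {T : ArrivalPath → ℝ≥0} (hT : Measurable T) :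
    Measurable fun p : ArrivalPath => p.1 (T p) :=
  measurable_eval_uncurry.comp (hT.prodMk measurable_id)

lemma measurable_shift_comp {T : ArrivalPath → ℝ≥0} (hT : Measurable T) :
    Measurable fun p : ArrivalPath => shift (T p) p :=
  measurable_shift_uncurry.comp (hT.prodMk measurable_id)

/-- The first point of the grid `ℕ / (k + 1)` that is not before the first arrival. -/
def gridArrival (k : ℕ) (p : ArrivalPath) : ℝ≥0 := gridCeil k p.firstArrival

lemma measurable_gridArrival (k : ℕ) : Measurable (gridArrival k) := by
  unfold gridArrival gridCeil
  have := measurable_firstArrival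
  fun_prop

/-- The first arrival lies in the cell `(j / (k + 1), (j + 1) / (k + 1)]` of the grid iff the path
is zero at the left end of the cell and nonzero at the right end. -/
lemma HasArrival.ceil_eq_iff {p : ArrivalPath} (hp : p.HasArrival) (k j : ℕ) :
    ⌈p.firstArrival * (k + 1)⌉₊ = j + 1 ↔
      p.1 (j / (k + 1)) = 0 ∧ p.1 ((j + 1 : ℕ) / (k + 1)) ≠ 0 := by
  have h : p.1 (j / (k + 1)) = 0 ↔ (j : ℝ≥0) / (k + 1) < p.firstArrival := by
    rw [← not_iff_not, not_lt, hp.firstArrival_le_iff]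
  rw [Nat.ceil_eq_iff (by omega), Nat.add_sub_cancel, ← hp.firstArrival_le_iff, h,
    div_lt_iff₀ (by positivity), le_div_iff₀ (by positivity)]

lemma HasArrival.ceil_ne_zero {p : ArrivalPath} (hp : p.HasArrival) (k : ℕ) :
    ⌈p.firstArrival * (k + 1)⌉₊ ≠ 0 := by
  intro h
  rw [Nat.ceil_eq_zero, nonpos_iff_eq_zero, mul_eq_zero] at h
  rcases h with h | h
  · exact hp.firstArrival_le_iff.1 h.le p.zero
  · exact absurd h (by positivity)

end ArrivalPath

section StrongMarkov

variable {rA rB : ℝ≥0} {ν : Measure ArrivalPath}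

lemma IsPoissonLaw.ae_hasArrival (hν : IsPoissonLaw rA rB ν) (hrA : 0 < rA) :
    ∀ᵐ p ∂ν, p.HasArrival := by
  -- The count at node `A` is still zero at time `n` with probability `exp (-rA * n)`.
  have hle : ∀ n : ℕ, ν {p | ¬ p.HasArrival} ≤ ENNReal.ofReal (Real.exp (-rA) ^ n) := by
    intro n
    calc ν {p | ¬ p.HasArrival} ≤ ν {p | p.1 n = 0} :=
          measure_mono fun p hp => by_contra fun h => hp ⟨n, h⟩
      _ ≤ poissonMeasure (rA * n) {0} := by
          rw [hν.measure_eval]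
          exact mul_le_of_le_one_right' prob_le_one
      _ = ENNReal.ofReal (Real.exp (-rA) ^ n) := by
          rw [poissonMeasure_singleton, ← Real.exp_nat_mul]
          simp [mul_comm]
  have hlim : Tendsto (fun n : ℕ => ENNReal.ofReal (Real.exp (-rA) ^ n)) atTop (𝓝 0) := by
    rw [← ENNReal.ofReal_zero]
    refine ENNReal.tendsto_ofReal (tendsto_pow_atTop_nhds_zero_of_lt_one (Real.exp_pos _).le ?_)
    rw [Real.exp_lt_one_iff]
    simpa using hrA
  exact le_antisymm (ge_of_tendsto' hlim hle) zero_le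

lemma poissonMeasure_singleton_pos {r : ℝ≥0} (hr : 0 < r) (n : ℕ) :
    0 < poissonMeasure r {n} := by
  rw [poissonMeasure_singleton, ENNReal.ofReal_pos]
  have : (0 : ℝ) < r := hr
  positivity

lemma IsPoissonLaw.measure_eval_pos (hν : IsPoissonLaw rA rB ν) (hrA : 0 < rA) (hrB : 0 < rB)
    {s : ℝ≥0} (hs : 0 < s) (v : ℕ × ℕ) : 0 < ν {p | p.1 s = v} := by
  rw [hν.measure_eval]
  exact ENNReal.mul_pos (poissonMeasure_singleton_pos (by positivity) _).ne'
    (poissonMeasure_singleton_pos (by positivity) _).ne'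

lemma lintegral_comp_eq_tsum {α : Type*} [MeasurableSpace α] (m : Measure α) {f : α → ℕ × ℕ}
    (hf : Measurable f) (g : ℕ × ℕ → ℝ≥0∞) :
    ∫⁻ a, g (f a) ∂m = ∑' v, g v * m {a | f a = v} := by
  rw [← lintegral_map (f := g) .of_discrete hf, lintegral_countable']
  refine tsum_congr fun v => ?_
  rw [Measure.map_apply hf (measurableSet_singleton v)]
  rfl

variable [IsProbabilityMeasure ν]

/-- The joint law of the position of the path at the first grid point after the first arrival and of
the shifted path, by the Markov property at all points of the grid. -/
lemma IsPoissonLaw.measure_gridArrival (hν : IsPoissonLaw rA rB ν) (hrA : 0 < rA) (k : ℕ)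
    {v : ℕ × ℕ} (hv : v ≠ 0) {B : Set ArrivalPath} (hB : MeasurableSet B) :
    ν {p | p.1 (gridArrival k p) = v ∧ shift (gridArrival k p) p ∈ B} =
      (∑' j : ℕ, ν {p | p.1 (j / (k + 1)) = 0}) * ν {p | p.1 (1 / (k + 1)) = v} * ν B := by
  set E := {p | p.1 (gridArrival k p) = v ∧ shift (gridArrival k p) p ∈ B} with hE
  have hf : Measurable fun p : ArrivalPath => ⌈p.firstArrival * (k + 1)⌉₊ := by
    have := measurable_firstArrival
    fun_prop
  have hae := hν.ae_hasArrival hrA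
  have h0 : ν (E ∩ (fun p : ArrivalPath => ⌈p.firstArrival * (k + 1)⌉₊) ⁻¹' {0}) = 0 := by
    refine measure_mono_null (fun p hp => ?_) hae
    exact fun h => h.ceil_ne_zero k hp.2
  have hj : ∀ j : ℕ, ν (E ∩ (fun p : ArrivalPath => ⌈p.firstArrival * (k + 1)⌉₊) ⁻¹' {j + 1}) =
      ν {p | p.1 (j / (k + 1)) = 0} * (ν {p | p.1 (1 / (k + 1)) = v} * ν B) := by
    intro j
    have hadd : (j : ℝ≥0) / (k + 1) + 1 / (k + 1) = ((j + 1 : ℕ) : ℝ≥0) / (k + 1) := by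
      rw [← add_div, Nat.cast_succ]
    rw [← hν.measure_eval_inter_shift _ _ hB]
    have hB' : MeasurableSet
        {p : ArrivalPath | p.1 (1 / (k + 1)) = v ∧ shift (1 / (k + 1)) p ∈ B} :=
      (measurable_eval _ (measurableSet_singleton v)).inter (measurable_shift _ hB)
    rw [← hν.measure_eval_inter_shift _ _ hB']
    refine measure_congr ?_
    filter_upwards [hae] with p hp
    refine propext ?_
    change (p ∈ E ∧ ⌈p.firstArrival * (k + 1)⌉₊ = j + 1) ↔ (p.1 (j / (k + 1)) = 0 ∧
      (shift (j / (k + 1)) p).1 (1 / (k + 1)) = v ∧ shift (1 / (k + 1)) (shift (j / (k + 1)) p) ∈ B)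
    rw [shift_shift, shift_apply, hadd, hp.ceil_eq_iff]
    have hg : ⌈p.firstArrival * (k + 1)⌉₊ = j + 1 →
        gridArrival k p = ((j + 1 : ℕ) : ℝ≥0) / (k + 1) := fun h => by
      rw [gridArrival, gridCeil, h]
    rw [hp.ceil_eq_iff] at hg
    constructor
    · rintro ⟨⟨h1, h2⟩, h3⟩
      rw [hg h3] at h1 h2
      exact ⟨h3.1, by rw [h3.1, tsub_zero, h1], h2⟩
    · rintro ⟨h1, h2, h3⟩
      rw [h1, tsub_zero] at h2
      have h4 : p.1 (j / (k + 1)) = 0 ∧ p.1 ((j + 1 : ℕ) / (k + 1)) ≠ 0 := ⟨h1, by rwa [h2]⟩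
      refine ⟨⟨?_, ?_⟩, h4⟩
      · rw [hg h4, h2]
      · rwa [hg h4]
  rw [measure_eq_tsum_inter_preimage ν hf E, tsum_eq_zero_add' ENNReal.summable, h0, zero_add]
  simp_rw [hj]
  rw [ENNReal.tsum_mul_right, mul_assoc]

lemma IsPoissonLaw.measure_gridArrival_inter_shift (hν : IsPoissonLaw rA rB ν) (hrA : 0 < rA)
    (k : ℕ) (v : ℕ × ℕ) {B : Set ArrivalPath} (hB : MeasurableSet B) :
    ν {p | p.1 (gridArrival k p) = v ∧ shift (gridArrival k p) p ∈ B} =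
      ν {p | p.1 (gridArrival k p) = v} * ν B := by
  by_cases hv : v = 0
  · have h : ν {p | p.1 (gridArrival k p) = v} = 0 := by
      refine measure_mono_null (fun p hp => ?_) (hν.ae_hasArrival hrA)
      exact fun h => h.firstArrival_le_iff.1 (le_gridCeil k _) (hp.trans hv)
    rw [h, zero_mul]
    exact measure_mono_null (fun p hp => hp.1) h
  · have h := hν.measure_gridArrival hrA k hv MeasurableSet.univ
    simp only [Set.mem_univ, and_true, measure_univ, mul_one] at h
    rw [hν.measure_gridArrival hrA k hv hB, h]

/-- The **strong Markov property** at the first arrival: the arrivals after the first arrival are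
independent of it. The grid points after the first arrival decrease to it, and a right-continuous
path is eventually constant along them, so that probabilities of cylinders pass to the limit. -/
theorem IsPoissonLaw.measure_firstArrival_inter_shift (hν : IsPoissonLaw rA rB ν) (hrA : 0 < rA)
    (v : ℕ × ℕ) {B : Set ArrivalPath} (hB : MeasurableSet B) :
    ν {p | p.1 p.firstArrival = v ∧ shift p.firstArrival p ∈ B} =
      ν {p | p.1 p.firstArrival = v} * ν B := by
  have hT := measurable_firstArrival
  have hmv : MeasurableSet {p : ArrivalPath | p.1 p.firstArrival = v} :=
    measurable_eval_comp hT (measurableSet_singleton v)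
  have hmvk : ∀ k, MeasurableSet {p : ArrivalPath | p.1 (gridArrival k p) = v} := fun k =>
    measurable_eval_comp (measurable_gridArrival k) (measurableSet_singleton v)
  have hev : ∀ (p : ArrivalPath) (u : ℝ≥0), ∀ᶠ k in atTop,
      p.1 (gridArrival k p + u) = p.1 (p.firstArrival + u) := fun p u =>
    p.eventually_eq (fun k => by gcongr; exact le_gridCeil k _)
      ((tendsto_gridCeil _).add_const u)
  have hev0 : ∀ p : ArrivalPath, ∀ᶠ k in atTop, p.1 (gridArrival k p) = p.1 p.firstArrival :=
    fun p => by simpa using hev p 0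
  have hlim0 : Tendsto (fun k => ν {p | p.1 (gridArrival k p) = v}) atTop
      (𝓝 (ν {p | p.1 p.firstArrival = v})) := by
    refine tendsto_measure_of_tendsto_indicator_of_isFiniteMeasure atTop ν hmvk fun p => ?_
    filter_upwards [hev0 p] with k hk
    simp only [hk]
  have key : (ν.restrict {p | p.1 p.firstArrival = v}).map (fun p => shift p.firstArrival p) =
      ν {p | p.1 p.firstArrival = v} • ν := by
    refine ext_of_pathCylinder fun t c n _ _ _ _ => ?_
    have hc := measurableSet_pathCylinder t c n
    rw [Measure.map_apply (measurable_shift_comp hT) hc,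
      Measure.restrict_apply (measurable_shift_comp hT hc), Measure.smul_apply, smul_eq_mul]
    have hlim1 : Tendsto (fun k => ν {p | p.1 (gridArrival k p) = v ∧
        shift (gridArrival k p) p ∈ pathCylinder t c n}) atTop
        (𝓝 (ν ((fun p => shift p.firstArrival p) ⁻¹' pathCylinder t c n ∩
          {p | p.1 p.firstArrival = v}))) := by
      refine tendsto_measure_of_tendsto_indicator_of_isFiniteMeasure atTop ν (fun k =>
        (hmvk k).inter (measurable_shift_comp (measurable_gridArrival k) hc)) fun p => ?_
      have h2 : ∀ᶠ k in atTop, ∀ i ∈ Finset.range (n + 1),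
          p.1 (gridArrival k p + t i) = p.1 (p.firstArrival + t i) :=
        (Filter.eventually_all_finset _).2 fun i _ => hev p (t i)
      filter_upwards [hev0 p, h2] with k hk hk2
      have h3 : ∀ i ≤ n, (shift (gridArrival k p) p).1 (t i) =
          (shift p.firstArrival p).1 (t i) := fun i hi => by
        rw [shift_apply, shift_apply, hk, hk2 i (Finset.mem_range.2 (by omega))]
      simp only [Set.mem_ofPred_eq, Set.mem_inter_iff, Set.mem_preimage, pathCylinder, hk]
      rw [and_comm]
      refine and_congr_left fun _ => forall₂_congr fun i hi => ?_
      rw [h3 i hi]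
    simp_rw [hν.measure_gridArrival_inter_shift hrA _ v hc] at hlim1
    exact tendsto_nhds_unique hlim1 (ENNReal.Tendsto.mul_const hlim0 (Or.inr (measure_ne_top _ _)))
  have h := congrArg (fun m => m B) key
  simp only [Measure.map_apply (measurable_shift_comp hT) hB,
    Measure.restrict_apply (measurable_shift_comp hT hB), Measure.smul_apply, smul_eq_mul] at h
  rw [← h]
  congr 1
  ext p
  exact and_comm

/-- Moments of the counts at the first arrival: these are no larger than the counts at the next
integer time, whose law is, apart from the value `0`, a multiple of the law of the counts at
time `1`. That two arrivals at the same time have probability zero is not needed. -/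
lemma IsPoissonLaw.exists_lintegral_firstArrival_le (hν : IsPoissonLaw rA rB ν) (hrA : 0 < rA)
    (hrB : 0 < rB) : ∃ g : ℝ≥0∞, g ≠ ∞ ∧ ∀ f : ℕ × ℕ → ℝ≥0∞, Monotone f →
      ∫⁻ p, f (p.1 p.firstArrival) ∂ν ≤ f 0 + g * ∫⁻ p, f (p.1 1) ∂ν := by
  set g := ∑' j : ℕ, ν {p | p.1 (j / ((0 : ℕ) + 1)) = 0} with hg
  have h1 : ∀ v : ℕ × ℕ, v ≠ 0 → ν {p | p.1 (gridArrival 0 p) = v} = g * ν {p | p.1 1 = v} := by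
    intro v hv
    have := hν.measure_gridArrival hrA 0 hv MeasurableSet.univ
    simpa [hg] using this
  refine ⟨g, fun htop => ?_, fun f hf => ?_⟩
  -- The factor `g` is finite since it turns a positive probability into a probability.
  · have h2 := h1 (1, 0) (by simp)
    rw [htop, ENNReal.top_mul (hν.measure_eval_pos hrA hrB one_pos _).ne'] at h2
    exact measure_ne_top _ _ h2
  · calc ∫⁻ p, f (p.1 p.firstArrival) ∂ν ≤ ∫⁻ p, f (p.1 (gridArrival 0 p)) ∂ν :=
          lintegral_mono fun p => hf (p.monotone (le_gridCeil 0 _))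
      _ = ∑' v, f v * ν {p | p.1 (gridArrival 0 p) = v} :=
          lintegral_comp_eq_tsum ν (measurable_eval_comp (measurable_gridArrival 0)) f
      _ ≤ ∑' v, ((if v = 0 then f 0 else 0) + g * (f v * ν {p | p.1 1 = v})) := by
          refine ENNReal.tsum_le_tsum fun v => ?_
          by_cases hv : v = 0
          · subst hv
            simp only [if_true]
            exact (mul_le_of_le_one_right' prob_le_one).trans le_self_add
          · rw [h1 v hv, if_neg hv, zero_add, mul_left_comm]
      _ = f 0 + g * ∫⁻ p, f (p.1 1) ∂ν := by
          rw [ENNReal.tsum_add, ENNReal.tsum_mul_left, tsum_ite_eq,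
            lintegral_comp_eq_tsum ν (measurable_eval 1)]

end StrongMarkov

/-! ### The queues as a Markov chain -/

section Step

variable (C : Capacities) (ℓ : ℝ≥0)

/-- The queues after a transmission that starts with the queues `v`, if the arrivals from its start
on are given by the path `r`. -/
def serve (v : ℕ × ℕ) (r : ArrivalPath) : ℕ × ℕ := v - departures v + r.1 (duration C ℓ v)

/-- The queues after the next transmission, if the queues are now `q` and the arrivals from now on
are given by the path `p`. -/
def nextQueues (q : ℕ × ℕ) (p : ArrivalPath) : ℕ × ℕ :=
  if q = 0 then serve C ℓ (p.1 p.firstArrival) (shift p.firstArrival p) else serve C ℓ q p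

/-- The time until the end of the next transmission, if the queues are now `q` and the arrivals from
now on are given by the path `p`. -/
def nextTime (q : ℕ × ℕ) (p : ArrivalPath) : ℝ≥0 :=
  if q = 0 then p.firstArrival + duration C ℓ (p.1 p.firstArrival) else duration C ℓ q

lemma measurable_serve (v : ℕ × ℕ) : Measurable (serve C ℓ v) :=
  (measurable_of_countable fun x => v - departures v + x).comp (measurable_eval _)

lemma measurable_nextQueues (q : ℕ × ℕ) : Measurable (nextQueues C ℓ q) := by
  unfold nextQueues
  split_ifs
  · have h : Measurable fun x : (ℕ × ℕ) × ArrivalPath => serve C ℓ x.1 x.2 :=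
      measurable_from_prod_countable_right fun v => measurable_serve C ℓ v
    exact h.comp ((measurable_eval_comp measurable_firstArrival).prodMk
      (measurable_shift_comp measurable_firstArrival))
  · exact measurable_serve C ℓ q

lemma measurable_nextTime (q : ℕ × ℕ) : Measurable (nextTime C ℓ q) := by
  unfold nextTime
  split_ifs
  · exact measurable_firstArrival.add ((measurable_of_countable (duration C ℓ)).comp
      (measurable_eval_comp measurable_firstArrival))
  · exact measurable_const

lemma nextArrival_eq {p : ArrivalPath} {s : ℝ≥0} (h : (shift s p).HasArrival) :
    nextArrival (fun t => (p.1 t).1) (fun t => (p.1 t).2) s = s + (shift s p).firstArrival := by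
  have hiff : ∀ u, s ≤ u → (((p.1 s).1 < (p.1 u).1 ∨ (p.1 s).2 < (p.1 u).2) ↔
      (shift s p).1 (u - s) ≠ 0) := by
    intro u hu
    rw [shift_apply, add_tsub_cancel_of_le hu, Ne, Prod.ext_iff]
    simp only [Prod.fst_sub, Prod.snd_sub, Prod.fst_zero, Prod.snd_zero]
    omega
  refine IsLeast.csInf_eq ⟨⟨le_self_add, ?_⟩, fun u hu => ?_⟩
  · rw [hiff _ le_self_add, add_tsub_cancel_left]
    exact h.firstArrival_le_iff.1 le_rfl
  · rw [← le_tsub_iff_left hu.1, h.firstArrival_le_iff]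
    exact (hiff u hu.1).1 hu.2

/-- One step of the system is a function of the queues and of the arrivals from now on. -/
lemma step_eq {p : ArrivalPath} {s : ℝ≥0} {q : ℕ × ℕ} (h : q ≠ 0 ∨ (shift s p).HasArrival) :
    step C ℓ (fun t => (p.1 t).1) (fun t => (p.1 t).2) (s, q) =
      (s + nextTime C ℓ q (shift s p), nextQueues C ℓ q (shift s p)) := by
  have hw : ∀ s t (v : ℕ × ℕ), withArrivals (fun t => (p.1 t).1) (fun t => (p.1 t).2) s t v =
      v + (p.1 t - p.1 s) := fun _ _ _ => rfl
  by_cases hq : q = 0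
  · subst hq
    have h' : (shift s p).HasArrival := by simpa using h
    simp only [step, startTime, nextTime, nextQueues, serve, hw, if_true,
      if_pos (show (0 : ℕ × ℕ) = (0, 0) from rfl), nextArrival_eq h', zero_add]
    rw [← shift_apply, shift_shift, add_assoc, shift_apply _ (duration _ _ _), add_assoc]
  · simp only [step, startTime, nextTime, nextQueues, serve, hw]
    rw [if_neg (show ¬ q = (0, 0) from hq), if_neg hq, if_neg hq, tsub_self, add_zero, shift_apply]

/-- If there are no more arrivals, the system restarts at time `0` with empty queues, by the
convention for `nextArrival`. This matters only for measurability. -/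
lemma step_eq_zero {p : ArrivalPath} {s : ℝ≥0} (h : ¬ (shift s p).HasArrival) :
    step C ℓ (fun t => (p.1 t).1) (fun t => (p.1 t).2) (s, 0) = (0, 0) := by
  have hna : nextArrival (fun t => (p.1 t).1) (fun t => (p.1 t).2) s = 0 := by
    have : {u | s ≤ u ∧ ((p.1 s).1 < (p.1 u).1 ∨ (p.1 s).2 < (p.1 u).2)} = ∅ := by
      refine Set.eq_empty_iff_forall_notMem.2 fun u hu => h ⟨u - s, ?_⟩
      rw [shift_apply, add_tsub_cancel_of_le hu.1, Ne, Prod.ext_iff]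
      simp only [Prod.fst_sub, Prod.snd_sub, Prod.fst_zero, Prod.snd_zero]
      have := hu.2
      omega
    rw [nextArrival, this, NNReal.sInf_empty]
  have h0 : (0 : ℕ × ℕ) = (0, 0) := rfl
  simp [step, startTime, h0, hna, withArrivals, p.zero, duration, departures]

/-- The state (time, queues) after `n` transmissions, as a function of the arrival path. -/
def orbit (q₀ : ℕ × ℕ) (n : ℕ) (p : ArrivalPath) : ℝ≥0 × (ℕ × ℕ) :=
  (step C ℓ (fun t => (p.1 t).1) (fun t => (p.1 t).2))^[n] (0, q₀)

lemma orbit_succ (q₀ : ℕ × ℕ) (n : ℕ) (p : ArrivalPath) : orbit C ℓ q₀ (n + 1) p =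
    step C ℓ (fun t => (p.1 t).1) (fun t => (p.1 t).2) (orbit C ℓ q₀ n p) :=
  Function.iterate_succ_apply' _ _ _

lemma measurable_step : Measurable fun x : (ℝ≥0 × (ℕ × ℕ)) × ArrivalPath =>
    step C ℓ (fun t => (x.2.1 t).1) (fun t => (x.2.1 t).2) x.1 := by
  classical
  have hs : Measurable fun x : (ℝ≥0 × (ℕ × ℕ)) × ArrivalPath => shift x.1.1 x.2 :=
    measurable_shift_uncurry.comp (f := fun x : (ℝ≥0 × (ℕ × ℕ)) × ArrivalPath => (x.1.1, x.2))
      (by fun_prop)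
  have hqs : Measurable fun x : (ℝ≥0 × (ℕ × ℕ)) × ArrivalPath => (x.1.2, shift x.1.1 x.2) :=
    (by fun_prop : Measurable fun x : (ℝ≥0 × (ℕ × ℕ)) × ArrivalPath => x.1.2).prodMk hs
  have hQ : Measurable fun x : (ℝ≥0 × (ℕ × ℕ)) × ArrivalPath =>
      nextQueues C ℓ x.1.2 (shift x.1.1 x.2) :=
    (measurable_from_prod_countable_right (f := fun x : (ℕ × ℕ) × ArrivalPath =>
      nextQueues C ℓ x.1 x.2) fun q => measurable_nextQueues C ℓ q).comp hqs
  have hT : Measurable fun x : (ℝ≥0 × (ℕ × ℕ)) × ArrivalPath =>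
      nextTime C ℓ x.1.2 (shift x.1.1 x.2) :=
    (measurable_from_prod_countable_right (f := fun x : (ℕ × ℕ) × ArrivalPath =>
      nextTime C ℓ x.1 x.2) fun q => measurable_nextTime C ℓ q).comp hqs
  have hset : MeasurableSet {x : (ℝ≥0 × (ℕ × ℕ)) × ArrivalPath |
      x.1.2 ≠ 0 ∨ (shift x.1.1 x.2).HasArrival} :=
    (((measurable_snd.comp measurable_fst) (measurableSet_singleton 0)).compl).union
      (hs measurableSet_hasArrival)
  have e : (fun x : (ℝ≥0 × (ℕ × ℕ)) × ArrivalPath =>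
      step C ℓ (fun t => (x.2.1 t).1) (fun t => (x.2.1 t).2) x.1) =
      fun x => if x.1.2 ≠ 0 ∨ (shift x.1.1 x.2).HasArrival then
        (x.1.1 + nextTime C ℓ x.1.2 (shift x.1.1 x.2), nextQueues C ℓ x.1.2 (shift x.1.1 x.2))
        else (0, 0) := by
    funext ⟨⟨s, q⟩, p⟩
    simp only
    split_ifs with h
    · exact step_eq C ℓ h
    · push Not at h
      rw [h.1]
      exact step_eq_zero C ℓ h.2
  rw [e]
  exact Measurable.ite hset (((measurable_fst.comp measurable_fst).add hT).prodMk hQ)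
    measurable_const

lemma measurable_orbit (q₀ : ℕ × ℕ) (n : ℕ) : Measurable (orbit C ℓ q₀ n) := by
  induction n with
  | zero => exact measurable_const
  | succ n ih =>
    simp_rw [funext (orbit_succ C ℓ q₀ n)]
    exact (measurable_step C ℓ).comp (ih.prodMk measurable_id)

end Step

section Chain

variable {C : Capacities} {ℓ : ℝ≥0} {rA rB : ℝ≥0} {ν : Measure ArrivalPath}
  [IsProbabilityMeasure ν]

/-- A transmission that starts with given queues ends at a fixed time, at which the Markov property
of the arrivals applies. -/
lemma IsPoissonLaw.measure_serve_inter_shift (hν : IsPoissonLaw rA rB ν) (v y : ℕ × ℕ)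
    {B : Set ArrivalPath} (hB : MeasurableSet B) :
    ν {p | serve C ℓ v p = y ∧ shift (duration C ℓ v) p ∈ B} =
      ν {p | serve C ℓ v p = y} * ν B := by
  by_cases h : v - departures v ≤ y
  · have e : ∀ p, serve C ℓ v p = y ↔ p.1 (duration C ℓ v) = y - (v - departures v) := by
      intro p
      have h1 := h.1
      have h2 := h.2
      simp only [serve, Prod.ext_iff, Prod.fst_add, Prod.snd_add, Prod.fst_sub, Prod.snd_sub]
        at h1 h2 ⊢
      omega
    simp_rw [e]
    exact hν.measure_eval_inter_shift _ _ hB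
  · have e : ∀ p, serve C ℓ v p ≠ y := fun p hp => h (hp ▸ le_self_add)
    simp [e]

/-- From the empty system, the Markov property is applied twice: at the first arrival, and at the
end of the transmission that starts there. -/
lemma IsPoissonLaw.measure_nextQueues_zero (hν : IsPoissonLaw rA rB ν) (hrA : 0 < rA) (y : ℕ × ℕ)
    {B : Set ArrivalPath} (hB : MeasurableSet B) :
    ν {p | nextQueues C ℓ 0 p = y ∧ shift (nextTime C ℓ 0 p) p ∈ B} =
      ∑' v, ν {p | p.1 p.firstArrival = v} * (ν {p | serve C ℓ v p = y} * ν B) := by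
  rw [measure_eq_tsum_inter_preimage ν (measurable_eval_comp measurable_firstArrival)]
  refine tsum_congr fun v => ?_
  have hBv : MeasurableSet {r | serve C ℓ v r = y ∧ shift (duration C ℓ v) r ∈ B} :=
    (measurable_serve C ℓ v (measurableSet_singleton y)).inter (measurable_shift _ hB)
  rw [← hν.measure_serve_inter_shift v y hB, ← hν.measure_firstArrival_inter_shift hrA v hBv]
  congr 1
  ext p
  simp only [Set.mem_inter_iff, Set.mem_ofPred_eq, Set.mem_preimage, Set.mem_singleton_iff,
    nextQueues, nextTime, if_true, shift_shift]
  constructor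
  · rintro ⟨⟨h1, h2⟩, h3⟩
    rw [h3] at h1 h2
    exact ⟨h3, h1, h2⟩
  · rintro ⟨h3, h1, h2⟩
    rw [h3]
    exact ⟨⟨h1, h2⟩, rfl⟩

/-- At the end of a transmission, the arrivals from then on are independent of the queues. -/
theorem IsPoissonLaw.measure_nextQueues_inter_shift (hν : IsPoissonLaw rA rB ν) (hrA : 0 < rA)
    (q y : ℕ × ℕ) {B : Set ArrivalPath} (hB : MeasurableSet B) :
    ν {p | nextQueues C ℓ q p = y ∧ shift (nextTime C ℓ q p) p ∈ B} =
      ν {p | nextQueues C ℓ q p = y} * ν B := by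
  by_cases hq : q = 0
  · subst hq
    have h := hν.measure_nextQueues_zero (C := C) (ℓ := ℓ) hrA y MeasurableSet.univ
    simp only [Set.mem_univ, and_true, measure_univ, mul_one] at h
    rw [hν.measure_nextQueues_zero hrA y hB, h, ← ENNReal.tsum_mul_right]
    exact tsum_congr fun v => (mul_assoc _ _ _).symm
  · simp only [nextQueues, nextTime, if_neg hq]
    exact hν.measure_serve_inter_shift q y hB

instance (q : ℕ × ℕ) : IsProbabilityMeasure (ν.map (nextQueues C ℓ q)) :=
  Measure.isProbabilityMeasure_map (measurable_nextQueues C ℓ q).aemeasurable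

variable (C ℓ ν) in
/-- The transition probabilities of the queues. -/
def transition (q : ℕ × ℕ) : PMF (ℕ × ℕ) := (ν.map (nextQueues C ℓ q)).toPMF

lemma transition_apply (q y : ℕ × ℕ) :
    transition C ℓ ν q y = ν {p | nextQueues C ℓ q p = y} := by
  rw [transition, Measure.toPMF_apply, Measure.map_apply (measurable_nextQueues C ℓ q)
    (measurableSet_singleton y)]
  rfl

/-- If the arrivals from the end of the `n`-th transmission on are independent of the past queue
lengths, then the next queue lengths depend on the past only through the present ones, and the
arrivals after the next transmission are independent of all these. -/
lemma IsPoissonLaw.measure_history_succ_inter_shift (hν : IsPoissonLaw rA rB ν) (hrA : 0 < rA)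
    (q₀ : ℕ × ℕ) (n : ℕ) (s : ℕ → ℕ × ℕ)
    (ih : ∀ {B : Set ArrivalPath}, MeasurableSet B →
      ν {p | (∀ k ≤ n, (orbit C ℓ q₀ k p).2 = s k) ∧ shift (orbit C ℓ q₀ n p).1 p ∈ B} =
        ν {p | ∀ k ≤ n, (orbit C ℓ q₀ k p).2 = s k} * ν B)
    {B : Set ArrivalPath} (hB : MeasurableSet B) :
    ν {p | (∀ k ≤ n + 1, (orbit C ℓ q₀ k p).2 = s k) ∧
        shift (orbit C ℓ q₀ (n + 1) p).1 p ∈ B} =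
      ν {p | ∀ k ≤ n, (orbit C ℓ q₀ k p).2 = s k} *
        (ν {p | nextQueues C ℓ (s n) p = s (n + 1)} * ν B) := by
  rw [← hν.measure_nextQueues_inter_shift hrA _ _ hB]
  have hB' : MeasurableSet {p | nextQueues C ℓ (s n) p = s (n + 1) ∧
      shift (nextTime C ℓ (s n) p) p ∈ B} :=
    (measurable_nextQueues C ℓ _ (measurableSet_singleton _)).inter
      (measurable_shift_comp (measurable_nextTime C ℓ _) hB)
  rw [← ih hB']
  -- `step_eq` needs that there is another arrival, which holds almost surely, by the independence
  -- of the history again.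
  have hnull : ∀ᵐ p ∂ν, ¬ ((∀ k ≤ n, (orbit C ℓ q₀ k p).2 = s k) ∧
      shift (orbit C ℓ q₀ n p).1 p ∈ {p | p.HasArrival}ᶜ) := by
    have h0 : ν {p : ArrivalPath | p.HasArrival}ᶜ = 0 := hν.ae_hasArrival hrA
    have h1 := ih measurableSet_hasArrival.compl
    rw [h0, mul_zero] at h1
    exact measure_eq_zero_iff_ae_notMem.1 h1
  refine measure_congr ?_
  filter_upwards [hnull] with p hp
  refine propext ?_
  change ((∀ k ≤ n + 1, (orbit C ℓ q₀ k p).2 = s k) ∧ shift (orbit C ℓ q₀ (n + 1) p).1 p ∈ B) ↔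
    ((∀ k ≤ n, (orbit C ℓ q₀ k p).2 = s k) ∧
      nextQueues C ℓ (s n) (shift (orbit C ℓ q₀ n p).1 p) = s (n + 1) ∧
      shift (nextTime C ℓ (s n) (shift (orbit C ℓ q₀ n p).1 p))
        (shift (orbit C ℓ q₀ n p).1 p) ∈ B)
  have hsucc : (∀ k ≤ n + 1, (orbit C ℓ q₀ k p).2 = s k) ↔
      (∀ k ≤ n, (orbit C ℓ q₀ k p).2 = s k) ∧ (orbit C ℓ q₀ (n + 1) p).2 = s (n + 1) := by
    simp only [Nat.le_succ_iff, or_imp, forall_and, forall_eq]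
  rw [hsucc, and_assoc]
  refine and_congr_right fun hist => ?_
  have harr : (shift (orbit C ℓ q₀ n p).1 p).HasArrival := by
    by_contra hcon
    exact hp ⟨hist, hcon⟩
  have hstep : orbit C ℓ q₀ (n + 1) p =
      ((orbit C ℓ q₀ n p).1 + nextTime C ℓ (s n) (shift (orbit C ℓ q₀ n p).1 p),
        nextQueues C ℓ (s n) (shift (orbit C ℓ q₀ n p).1 p)) := by
    rw [orbit_succ, ← hist n le_rfl]
    exact step_eq C ℓ (Or.inr harr)
  rw [hstep, shift_shift]

/-- At the end of the `n`-th transmission, the arrivals from then on are independent of the queue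
lengths observed so far, with the same law as at time `0`. -/
theorem IsPoissonLaw.measure_history_inter_shift (hν : IsPoissonLaw rA rB ν) (hrA : 0 < rA)
    (q₀ : ℕ × ℕ) (n : ℕ) (s : ℕ → ℕ × ℕ) {B : Set ArrivalPath} (hB : MeasurableSet B) :
    ν {p | (∀ k ≤ n, (orbit C ℓ q₀ k p).2 = s k) ∧ shift (orbit C ℓ q₀ n p).1 p ∈ B} =
      ν {p | ∀ k ≤ n, (orbit C ℓ q₀ k p).2 = s k} * ν B := by
  induction n generalizing B with
  | zero =>
    have e : ∀ p : ArrivalPath, shift (orbit C ℓ q₀ 0 p).1 p = p := fun p => shift_zero p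
    by_cases h : q₀ = s 0
    · have h' : ∀ p, ∀ k ≤ 0, (orbit C ℓ q₀ k p).2 = s k := by
        intro p k hk
        obtain rfl : k = 0 := by omega
        exact h
      simp [e, h']
    · have h' : ∀ p, (orbit C ℓ q₀ 0 p).2 ≠ s 0 := fun _ => h
      simp [h']
  | succ n ih =>
    have h1 := hν.measure_history_succ_inter_shift hrA q₀ n s ih MeasurableSet.univ
    simp only [Set.mem_univ, and_true, measure_univ, mul_one] at h1
    rw [hν.measure_history_succ_inter_shift hrA q₀ n s ih hB, h1, mul_assoc]

theorem IsPoissonLaw.isMarkovChain_orbit (hν : IsPoissonLaw rA rB ν) (hrA : 0 < rA) (q₀ : ℕ × ℕ) :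
    IsMarkovChain ν (transition C ℓ ν) q₀ fun n p => (orbit C ℓ q₀ n p).2 where
  measurable n := (measurable_orbit C ℓ q₀ n).snd
  start _ := rfl
  markov n s := by
    have h := hν.measure_history_succ_inter_shift (C := C) (ℓ := ℓ) hrA q₀ n s
      (hν.measure_history_inter_shift hrA q₀ n s) MeasurableSet.univ
    simp only [Set.mem_univ, and_true, measure_univ, mul_one] at h
    rw [transition_apply]
    exact h

end Chain

/-! ### The rate regions -/

section Region

/-- A linear function with positive coefficients is not maximal at an interior point. -/
lemma lt_of_mem_interior_of_le {S : Set (ℝ × ℝ)} {x y c : ℝ} (hxy : 0 < x ∧ 0 < y) {R : ℝ × ℝ}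
    (hS : ∀ R ∈ S, R.1 * x + R.2 * y ≤ c) (hR : R ∈ interior S) : R.1 * x + R.2 * y < c := by
  have h1 : Filter.Tendsto (fun e : ℝ => (R.1 + e, R.2)) (𝓝[>] 0) (𝓝 R) := by
    have : Continuous fun e : ℝ => (R.1 + e, R.2) := by fun_prop
    exact (this.tendsto' 0 R (by simp)).mono_left nhdsWithin_le_nhds
  have h2 := (h1.eventually (isOpen_interior.mem_nhds hR)).and self_mem_nhdsWithin
  obtain ⟨e, he, he0⟩ := h2.exists
  have h3 := hS _ (interior_subset he)
  have h4 : (0 : ℝ) < e := he0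
  simp only at h3
  nlinarith [mul_pos h4 hxy.1]

lemma pos_of_mem_interior {S : Set (ℝ × ℝ)} (hS : ∀ R ∈ S, 0 ≤ R.1 ∧ 0 ≤ R.2) {R : ℝ × ℝ}
    (hR : R ∈ interior S) : 0 < R.1 ∧ 0 < R.2 := by
  have h1 : Filter.Tendsto (fun e : ℝ => (R.1 - e, R.2 - e)) (𝓝[>] 0) (𝓝 R) := by
    have : Continuous fun e : ℝ => (R.1 - e, R.2 - e) := by fun_prop
    exact (this.tendsto' 0 R (by simp)).mono_left nhdsWithin_le_nhds
  have h2 := (h1.eventually (isOpen_interior.mem_nhds hR)).and self_mem_nhdsWithin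
  obtain ⟨e, he, he0⟩ := h2.exists
  have h3 := hS _ (interior_subset he)
  have h4 : (0 : ℝ) < e := he0
  simp only at h3
  exact ⟨by linarith, by linarith⟩

variable (C : Capacities)

lemma Capacities.Cmin_pos : 0 < C.Cmin := lt_min C.DA_pos C.DB_pos

lemma Capacities.one_div_Cmin : 1 / (C.DB : ℝ) ≤ 1 / C.Cmin ∧ 1 / (C.DA : ℝ) ≤ 1 / C.Cmin ∧
    1 / (C.Cmin : ℝ) ≤ 1 / C.DA + 1 / C.DB := by
  have hA : (0 : ℝ) < C.DA := C.DA_pos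
  have hB : (0 : ℝ) < C.DB := C.DB_pos
  have hC : (0 : ℝ) < C.Cmin := C.Cmin_pos
  refine ⟨one_div_le_one_div_of_le hC (mod_cast min_le_right _ _),
    one_div_le_one_div_of_le hC (mod_cast min_le_left _ _), ?_⟩
  have := one_div_pos.2 hA
  have := one_div_pos.2 hB
  rcases min_choice C.DA C.DB with h | h <;> rw [Capacities.Cmin, h] <;> linarith

/-- In both rate regions, the two loads below are at most `1`: these are the two nontrivial sides of
the polygon that is spanned by the regions. -/
lemma load_le_one {R : ℝ × ℝ} (hR : R ∈ regionTDMH C ∪ regionMLNC C) :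
    0 ≤ R.1 ∧ 0 ≤ R.2 ∧
      R.1 * (1 / C.AD + 1 / C.DB) + R.2 * (1 / C.BD + 1 / C.Cmin - 1 / C.DB) ≤ 1 ∧
      R.1 * (1 / C.AD + 1 / C.Cmin - 1 / C.DA) + R.2 * (1 / C.BD + 1 / C.DA) ≤ 1 := by
  have hAD : (0 : ℝ) < C.AD := C.AD_pos
  have hBD : (0 : ℝ) < C.BD := C.BD_pos
  have hDA : (0 : ℝ) < C.DA := C.DA_pos
  have hDB : (0 : ℝ) < C.DB := C.DB_pos
  have hC : (0 : ℝ) < C.Cmin := C.Cmin_pos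
  obtain ⟨m1, m2, m3⟩ := C.one_div_Cmin
  have key : ∀ {r w c : ℝ}, 0 < c → r ≤ w * c → r * (1 / c) ≤ w := by
    intro r w c hc h
    rw [mul_one_div, div_le_iff₀ hc]; exact h
  rcases hR with ⟨h1, h2, w, -, hw, ha, hb, hc, hd⟩ | ⟨h1, h2, w, -, hw, ha, hb, hc, hd⟩
  · rw [Fin.sum_univ_four] at hw
    have ka := key hAD ha
    have kb := key hDB hb
    have kc := key hBD hc
    have kd := key hDA hd
    have e1 : R.2 * (1 / C.Cmin - 1 / C.DB) ≤ R.2 * (1 / C.DA) :=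
      mul_le_mul_of_nonneg_left (by linarith) h2
    have e2 : R.1 * (1 / C.Cmin - 1 / C.DA) ≤ R.1 * (1 / C.DB) :=
      mul_le_mul_of_nonneg_left (by linarith) h1
    exact ⟨h1, h2, by linarith, by linarith⟩
  · rw [Fin.sum_univ_three] at hw
    have ka := key hAD ha
    have kc := key hBD hc
    have hone : w 2 * C.Cmin * (1 / C.Cmin) = w 2 := by field_simp
    have b1 := mul_le_mul_of_nonneg_right hb (one_div_nonneg.2 hDB.le)
    have b2 := mul_le_mul_of_nonneg_right hb (sub_nonneg.2 m2)
    have d1 := mul_le_mul_of_nonneg_right hd (one_div_nonneg.2 hDA.le)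
    have d2 := mul_le_mul_of_nonneg_right hd (sub_nonneg.2 m1)
    exact ⟨h1, h2, by linarith, by linarith⟩

variable {C}

lemma load_lt_one {R : ℝ × ℝ}
    (hR : R ∈ interior (convexHull ℝ (regionTDMH C ∪ regionMLNC C))) :
    0 < R.1 ∧ 0 < R.2 ∧
      R.1 * (1 / C.AD + 1 / C.DB) + R.2 * (1 / C.BD + 1 / C.Cmin - 1 / C.DB) < 1 ∧
      R.1 * (1 / C.AD + 1 / C.Cmin - 1 / C.DA) + R.2 * (1 / C.BD + 1 / C.DA) < 1 := by
  have hAD : (0 : ℝ) < 1 / C.AD := one_div_pos.2 C.AD_pos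
  have hBD : (0 : ℝ) < 1 / C.BD := one_div_pos.2 C.BD_pos
  have hDA : (0 : ℝ) < 1 / C.DA := one_div_pos.2 C.DA_pos
  have hDB : (0 : ℝ) < 1 / C.DB := one_div_pos.2 C.DB_pos
  obtain ⟨m1, m2, -⟩ := C.one_div_Cmin
  have hull : ∀ {x y c : ℝ}, (∀ R ∈ regionTDMH C ∪ regionMLNC C, R.1 * x + R.2 * y ≤ c) →
      ∀ R ∈ convexHull ℝ (regionTDMH C ∪ regionMLNC C), R.1 * x + R.2 * y ≤ c := by
    intro x y c h
    have hconv : Convex ℝ {R : ℝ × ℝ | R.1 * x + R.2 * y ≤ c} := by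
      refine convex_halfSpace_le (f := fun R : ℝ × ℝ => R.1 * x + R.2 * y) ⟨?_, ?_⟩ c
      · intro R R'; simp only [Prod.fst_add, Prod.snd_add]; ring
      · intro a R; simp only [Prod.smul_fst, Prod.smul_snd, smul_eq_mul]; ring
    exact fun R hR => convexHull_min (fun R hR => h R hR) hconv hR
  have hpos := pos_of_mem_interior (S := convexHull ℝ (regionTDMH C ∪ regionMLNC C))
    (fun R hR => by
      have h1 := hull (x := -1) (y := 0) (c := 0)
        (fun R hR => by linarith [(load_le_one C hR).1]) R hR
      have h2 := hull (x := 0) (y := -1) (c := 0)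
        (fun R hR => by linarith [(load_le_one C hR).2.1]) R hR
      exact ⟨by linarith, by linarith⟩) hR
  exact ⟨hpos.1, hpos.2,
    lt_of_mem_interior_of_le ⟨by linarith, by linarith⟩
      (hull fun R hR => (load_le_one C hR).2.2.1) hR,
    lt_of_mem_interior_of_le ⟨by linarith, by linarith⟩
      (hull fun R hR => (load_le_one C hR).2.2.2) hR⟩

end Region

/-! ### The Lyapunov function -/

section Lyapunov

/-- The quadratic form `α x² + 2 β x y + γ y²` of the queue lengths `(x, y)`, with values in
`ℝ≥0∞`. -/
def quad (α β γ : ℝ≥0) (q : ℕ × ℕ) : ℝ≥0∞ := α * q.1 ^ 2 + 2 * β * q.1 * q.2 + γ * q.2 ^ 2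

variable {C : Capacities} {ℓ rA rB : ℝ≥0}

/-- There is a quadratic form whose gradient at `q - departures q` has a negative product with the
mean change of the queues in a transmission. With the three transmission times `TA`, `TB`, `TM`,
`TA x + (TM - TA) y` and `(TM - TB) x + TB y` are the times that are needed to empty the queues
`(x, y)` if `y ≤ x` and if `x ≤ y`; the weights `TM - TB` and `TM - TA` of these two rows make the
matrix symmetric. -/
lemma exists_lyapunov (hℓ : 0 < ℓ)
    (hR : ((rA : ℝ) * (ℓ : ℝ), (rB : ℝ) * (ℓ : ℝ)) ∈
      interior (convexHull ℝ (regionTDMH C ∪ regionMLNC C))) :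
    ∃ (α β γ : ℝ≥0) (ε : ℝ), 0 < ε ∧ ∀ q : ℕ × ℕ, q ≠ 0 →
      ε * ((q - departures q).1 + (q - departures q).2) ≤
        (α * (q - departures q).1 + β * (q - departures q).2) *
            ((departures q).1 - rA * duration C ℓ q) +
          (β * (q - departures q).1 + γ * (q - departures q).2) *
            ((departures q).2 - rB * duration C ℓ q) := by
  obtain ⟨-, -, h1, h2⟩ := load_lt_one hR
  simp only at h1 h2
  have hl : (0 : ℝ) < ℓ := hℓ
  have hAD : (0 : ℝ) < 1 / C.AD := one_div_pos.2 C.AD_pos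
  have hBD : (0 : ℝ) < 1 / C.BD := one_div_pos.2 C.BD_pos
  have hDA : (0 : ℝ) < 1 / C.DA := one_div_pos.2 C.DA_pos
  have hDB : (0 : ℝ) < 1 / C.DB := one_div_pos.2 C.DB_pos
  obtain ⟨m1, m2, -⟩ := C.one_div_Cmin
  set TA : ℝ := ℓ * (1 / C.AD + 1 / C.DB) with hTA
  set TB : ℝ := ℓ * (1 / C.BD + 1 / C.DA) with hTB
  set TM : ℝ := ℓ * (1 / C.AD + 1 / C.BD + 1 / C.Cmin) with hTM
  have hTA0 : 0 < TA := mul_pos hl (by linarith)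
  have hTB0 : 0 < TB := mul_pos hl (by linarith)
  have hc : 0 < TM - TB := by
    rw [hTM, hTB, ← mul_sub]; exact mul_pos hl (by linarith)
  have hd : 0 < TM - TA := by
    rw [hTM, hTA, ← mul_sub]; exact mul_pos hl (by linarith)
  have hTM0 : 0 < TM := by linarith
  have hρ1 : 0 < 1 - (rA * TA + rB * (TM - TA)) := by
    have : rA * TA + rB * (TM - TA) = rA * ℓ * (1 / C.AD + 1 / C.DB) +
        rB * ℓ * (1 / C.BD + 1 / C.Cmin - 1 / C.DB) := by rw [hTM, hTA]; ring
    linarith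
  have hρ2 : 0 < 1 - (rA * (TM - TB) + rB * TB) := by
    have : rA * (TM - TB) + rB * TB = rA * ℓ * (1 / C.AD + 1 / C.Cmin - 1 / C.DA) +
        rB * ℓ * (1 / C.BD + 1 / C.DA) := by rw [hTM, hTB]; ring
    linarith
  set σ1 := 1 - (rA * TA + rB * (TM - TA)) with hσ1
  set σ2 := 1 - (rA * (TM - TB) + rB * TB) with hσ2
  -- The four slopes: along both coordinates after an exchange of a pair of packets, and along the
  -- only nonzero coordinate after a transmission of a single packet.
  set ε : ℝ := min (min ((TM - TB) * (TM * σ1)) ((TM - TA) * (TM * σ2)))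
    (min ((TM - TB) * (TA * σ1)) ((TM - TA) * (TB * σ2))) with hε
  have e1 : ε ≤ (TM - TB) * (TM * σ1) := (min_le_left _ _).trans (min_le_left _ _)
  have e2 : ε ≤ (TM - TA) * (TM * σ2) := (min_le_left _ _).trans (min_le_right _ _)
  have e3 : ε ≤ (TM - TB) * (TA * σ1) := (min_le_right _ _).trans (min_le_left _ _)
  have e4 : ε ≤ (TM - TA) * (TB * σ2) := (min_le_right _ _).trans (min_le_right _ _)
  refine ⟨((TM - TB) * TA).toNNReal, ((TM - TB) * (TM - TA)).toNNReal,
    ((TM - TA) * TB).toNNReal, ε, by rw [hε]; positivity, ?_⟩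
  rintro ⟨x, y⟩ hq
  rw [Real.coe_toNNReal _ (by positivity), Real.coe_toNNReal _ (by positivity),
    Real.coe_toNNReal _ (by positivity)]
  rcases Nat.eq_zero_or_pos x with rfl | hx <;> rcases Nat.eq_zero_or_pos y with rfl | hy
  · exact absurd rfl hq
  · have hdep : departures (0, y) = (0, 1) := by simp [departures, hy.ne']
    have hdur : (duration C ℓ (0, y) : ℝ) = TB := by
      simp [duration, hy.ne', hTB]; ring
    rw [hdep, hdur]
    have hm : (0 : ℝ) ≤ ((y - 1 : ℕ) : ℝ) := Nat.cast_nonneg _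
    simp only [Prod.mk_sub_mk, tsub_self, Nat.cast_zero, Nat.cast_one]
    have := mul_le_mul_of_nonneg_right e4 hm
    rw [hσ2] at this
    linarith
  · have hdep : departures (x, 0) = (1, 0) := by simp [departures, hx.ne']
    have hdur : (duration C ℓ (x, 0) : ℝ) = TA := by
      simp [duration, hx.ne', hTA]; ring
    rw [hdep, hdur]
    have hm : (0 : ℝ) ≤ ((x - 1 : ℕ) : ℝ) := Nat.cast_nonneg _
    simp only [Prod.mk_sub_mk, tsub_self, Nat.cast_zero, Nat.cast_one]
    have := mul_le_mul_of_nonneg_right e3 hm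
    rw [hσ1] at this
    linarith
  · have hdep : departures (x, y) = (1, 1) := by simp [departures, hx.ne', hy.ne']
    have hdur : (duration C ℓ (x, y) : ℝ) = TM := by
      simp [duration, hx.ne', hy.ne', hTM]; ring
    rw [hdep, hdur]
    have hm : (0 : ℝ) ≤ ((x - 1 : ℕ) : ℝ) := Nat.cast_nonneg _
    have hm' : (0 : ℝ) ≤ ((y - 1 : ℕ) : ℝ) := Nat.cast_nonneg _
    simp only [Prod.mk_sub_mk, Nat.cast_one]
    have h3 := mul_le_mul_of_nonneg_right e1 hm
    have h4 := mul_le_mul_of_nonneg_right e2 hm'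
    rw [hσ1] at h3
    rw [hσ2] at h4
    linarith

end Lyapunov

/-! ### Moments of the arrivals -/

section Moments

lemma lintegral_natCast_mul_poissonMeasure (r : ℝ≥0) (f : ℕ → ℝ≥0∞) :
    ∫⁻ n, n * f n ∂(poissonMeasure r) = r * ∫⁻ n, f (n + 1) ∂(poissonMeasure r) := by
  rw [lintegral_countable', lintegral_countable', tsum_eq_zero_add' ENNReal.summable,
    ← ENNReal.tsum_mul_left]
  simp only [Nat.cast_zero, zero_mul, zero_add]
  refine tsum_congr fun n => ?_
  have h : ((n + 1 : ℕ) : ℝ≥0∞) * poissonMeasure r {n + 1} = r * poissonMeasure r {n} := by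
    rw [poissonMeasure_singleton, poissonMeasure_singleton, ← ENNReal.ofReal_natCast,
      ← ENNReal.ofReal_coe_nnreal, ← ENNReal.ofReal_mul (by positivity),
      ← ENNReal.ofReal_mul (by positivity)]
    congr 1
    rw [Nat.factorial_succ]
    push_cast
    field_simp
    ring
  calc ((n + 1 : ℕ) : ℝ≥0∞) * f (n + 1) * poissonMeasure r {n + 1}
      = (((n + 1 : ℕ) : ℝ≥0∞) * poissonMeasure r {n + 1}) * f (n + 1) := by ring
    _ = _ := by rw [h]; ring

lemma lintegral_natCast_poissonMeasure (r : ℝ≥0) :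
    ∫⁻ n, (n : ℝ≥0∞) ∂(poissonMeasure r) = r := by
  simpa using lintegral_natCast_mul_poissonMeasure r fun _ => 1

lemma lintegral_natCast_sq_poissonMeasure (r : ℝ≥0) :
    ∫⁻ n, (n : ℝ≥0∞) ^ 2 ∂(poissonMeasure r) = r * (r + 1) := by
  simp_rw [pow_two]
  rw [lintegral_natCast_mul_poissonMeasure r fun n => (n : ℝ≥0∞)]
  simp_rw [Nat.cast_succ]
  rw [lintegral_add_right _ measurable_const, lintegral_natCast_poissonMeasure]
  simp

variable {rA rB : ℝ≥0} {ν : Measure ArrivalPath}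

lemma IsPoissonLaw.map_eval (hν : IsPoissonLaw rA rB ν) (s : ℝ≥0) :
    ν.map (fun p => p.1 s) = (poissonMeasure (rA * s)).prod (poissonMeasure (rB * s)) := by
  refine Measure.ext_of_singleton fun v => ?_
  rw [Measure.map_apply (measurable_eval s) (measurableSet_singleton v)]
  change ν {p | p.1 s = v} = _
  rw [hν.measure_eval, ← Set.singleton_prod_singleton, Measure.prod_prod]

lemma IsPoissonLaw.lintegral_fst (hν : IsPoissonLaw rA rB ν) (s : ℝ≥0) (f : ℕ → ℝ≥0∞) :
    ∫⁻ p, f (p.1 s).1 ∂ν = ∫⁻ n, f n ∂(poissonMeasure (rA * s)) := by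
  rw [← lintegral_map (f := fun v : ℕ × ℕ => f v.1) .of_discrete (measurable_eval s), hν.map_eval,
    lintegral_prod _ Measurable.of_discrete.aemeasurable]
  simp

lemma IsPoissonLaw.lintegral_snd (hν : IsPoissonLaw rA rB ν) (s : ℝ≥0) (f : ℕ → ℝ≥0∞) :
    ∫⁻ p, f (p.1 s).2 ∂ν = ∫⁻ n, f n ∂(poissonMeasure (rB * s)) := by
  rw [← lintegral_map (f := fun v : ℕ × ℕ => f v.2) .of_discrete (measurable_eval s), hν.map_eval,
    lintegral_prod _ Measurable.of_discrete.aemeasurable]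
  simp

/-- The sum of the squares of the queue lengths. -/
def sumSq (q : ℕ × ℕ) : ℝ≥0∞ := q.1 ^ 2 + q.2 ^ 2

lemma sumSq_mono : Monotone sumSq := fun x y h => by
  unfold sumSq
  gcongr
  · exact h.1
  · exact h.2

lemma sumSq_ne_top (q : ℕ × ℕ) : sumSq q ≠ ∞ := by
  simp [sumSq]

lemma sumSq_add_le (x y : ℕ × ℕ) : sumSq (x + y) ≤ 2 * sumSq x + 2 * sumSq y := by
  unfold sumSq
  have h : ∀ a b : ℕ, (a + b) ^ 2 ≤ 2 * a ^ 2 + 2 * b ^ 2 := fun a b => by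
    zify; nlinarith [sq_nonneg ((a : ℤ) - b)]
  have h1 := h x.1 y.1
  have h2 := h x.2 y.2
  have h3 : (x + y).1 ^ 2 + (x + y).2 ^ 2 ≤
      2 * (x.1 ^ 2 + x.2 ^ 2) + 2 * (y.1 ^ 2 + y.2 ^ 2) := by
    simp only [Prod.fst_add, Prod.snd_add]; omega
  exact_mod_cast h3

lemma quad_mono (α β γ : ℝ≥0) : Monotone (quad α β γ) := fun x y h => by
  have h1 := h.1
  have h2 := h.2
  unfold quad
  gcongr

lemma quad_ne_top (α β γ : ℝ≥0) (q : ℕ × ℕ) : quad α β γ q ≠ ∞ := by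
  have : quad α β γ q = ((α * q.1 ^ 2 + 2 * β * q.1 * q.2 + γ * q.2 ^ 2 : ℝ≥0) : ℝ≥0∞) := by
    simp [quad]
  rw [this]
  exact ENNReal.coe_ne_top

lemma quad_le (α β γ : ℝ≥0) (q : ℕ × ℕ) : quad α β γ q ≤ (α + β + γ : ℝ≥0) * sumSq q := by
  have h : (2 * q.1 * q.2 : ℝ≥0∞) ≤ q.1 ^ 2 + q.2 ^ 2 := by
    have : 2 * q.1 * q.2 ≤ q.1 ^ 2 + q.2 ^ 2 := by
      zify; nlinarith [sq_nonneg ((q.1 : ℤ) - q.2)]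
    exact_mod_cast this
  calc quad α β γ q = α * q.1 ^ 2 + β * (2 * q.1 * q.2) + γ * q.2 ^ 2 := by rw [quad]; ring
    _ ≤ α * (q.1 ^ 2 + q.2 ^ 2) + β * (q.1 ^ 2 + q.2 ^ 2) + γ * (q.1 ^ 2 + q.2 ^ 2) := by
        gcongr
        · exact le_self_add
        · exact le_add_self
    _ = (α + β + γ : ℝ≥0) * sumSq q := by rw [sumSq]; push_cast; ring

lemma quad_add (α β γ : ℝ≥0) (m z : ℕ × ℕ) : quad α β γ (m + z) =
    quad α β γ m + (2 * (α * m.1 + β * m.2) * z.1 + 2 * (β * m.1 + γ * m.2) * z.2) +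
      quad α β γ z := by
  simp only [quad, Prod.fst_add, Prod.snd_add]
  push_cast
  ring

lemma IsPoissonLaw.lintegral_sumSq_ne_top (hν : IsPoissonLaw rA rB ν) (s : ℝ≥0) :
    ∫⁻ p, sumSq (p.1 s) ∂ν ≠ ∞ := by
  have hm : Measurable fun p : ArrivalPath => ((p.1 s).1 : ℝ≥0∞) ^ 2 :=
    (measurable_of_countable fun v : ℕ × ℕ => (v.1 : ℝ≥0∞) ^ 2).comp (measurable_eval s)
  unfold sumSq
  rw [lintegral_add_left hm, hν.lintegral_fst s fun n => (n : ℝ≥0∞) ^ 2,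
    hν.lintegral_snd s fun n => (n : ℝ≥0∞) ^ 2, lintegral_natCast_sq_poissonMeasure,
    lintegral_natCast_sq_poissonMeasure]
  exact ENNReal.coe_ne_top (r := rA * s * (rA * s + 1) + rB * s * (rB * s + 1))

lemma IsPoissonLaw.lintegral_quad_ne_top (hν : IsPoissonLaw rA rB ν) (α β γ s : ℝ≥0) :
    ∫⁻ p, quad α β γ (p.1 s) ∂ν ≠ ∞ := by
  refine ne_top_of_le_ne_top ?_ (lintegral_mono fun p => quad_le α β γ (p.1 s))
  rw [lintegral_const_mul' _ _ ENNReal.coe_ne_top]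
  exact ENNReal.mul_ne_top ENNReal.coe_ne_top (hν.lintegral_sumSq_ne_top s)

lemma IsPoissonLaw.lintegral_quad_add [IsProbabilityMeasure ν] (hν : IsPoissonLaw rA rB ν)
    (α β γ s : ℝ≥0) (m : ℕ × ℕ) : ∫⁻ p, quad α β γ (m + p.1 s) ∂ν =
      quad α β γ m + (2 * (α * m.1 + β * m.2) * (rA * s : ℝ≥0) +
        2 * (β * m.1 + γ * m.2) * (rB * s : ℝ≥0)) + ∫⁻ p, quad α β γ (p.1 s) ∂ν := by
  have hm : ∀ g : ℕ × ℕ → ℝ≥0∞, Measurable fun p : ArrivalPath => g (p.1 s) := fun g =>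
    (measurable_of_countable g).comp (measurable_eval s)
  simp_rw [quad_add α β γ m]
  rw [lintegral_add_right _ (hm _), lintegral_add_left measurable_const,
    lintegral_add_left (hm fun v => 2 * (α * m.1 + β * m.2) * v.1),
    lintegral_const_mul _ (hm fun v => (v.1 : ℝ≥0∞)),
    lintegral_const_mul _ (hm fun v => (v.2 : ℝ≥0∞)), hν.lintegral_fst s fun n => (n : ℝ≥0∞),
    hν.lintegral_snd s fun n => (n : ℝ≥0∞), lintegral_natCast_poissonMeasure,
    lintegral_natCast_poissonMeasure]
  simp

end Moments

/-! ### Drift, irreducibility and stability -/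

section Stability

variable {C : Capacities} {ℓ : ℝ≥0} {rA rB : ℝ≥0} {ν : Measure ArrivalPath}

variable (C ℓ) in
/-- The sum of the durations of the three kinds of transmission, a bound for each of them. -/
def totalDuration : ℝ≥0 := duration C ℓ (1, 1) + duration C ℓ (1, 0) + duration C ℓ (0, 1)

lemma duration_le (v : ℕ × ℕ) : duration C ℓ v ≤ totalDuration C ℓ := by
  have h : duration C ℓ v = 0 ∨ duration C ℓ v = duration C ℓ (1, 1) ∨
      duration C ℓ v = duration C ℓ (1, 0) ∨ duration C ℓ v = duration C ℓ (0, 1) := by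
    unfold duration
    split_ifs <;> simp_all
  unfold totalDuration
  rcases h with h | h | h | h <;> rw [h]
  · exact zero_le
  · rw [add_assoc]; exact le_self_add
  · exact le_add_self.trans le_self_add
  · exact le_add_self

lemma duration_pos (hℓ : 0 < ℓ) {q : ℕ × ℕ} (hq : q ≠ 0) : 0 < duration C ℓ q := by
  have h1 : 0 < ℓ / C.AD := div_pos hℓ C.AD_pos
  have h2 : 0 < ℓ / C.BD := div_pos hℓ C.BD_pos
  unfold duration
  split_ifs with h h' h''
  · positivity
  · positivity
  · positivity
  · exact absurd (Prod.ext (not_not.1 h') (not_not.1 h'')) hq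

lemma serve_le (v : ℕ × ℕ) (r : ArrivalPath) : serve C ℓ v r ≤ v + r.1 (totalDuration C ℓ) :=
  add_le_add tsub_le_self (r.monotone (duration_le v))

lemma IsPoissonLaw.measure_serve_pos (hν : IsPoissonLaw rA rB ν) (hrA : 0 < rA) (hrB : 0 < rB)
    (hℓ : 0 < ℓ) {v y : ℕ × ℕ} (hv : v ≠ 0) (hy : v - departures v ≤ y) :
    ν {p | serve C ℓ v p = y} ≠ 0 := by
  refine ne_of_gt ((hν.measure_eval_pos hrA hrB (duration_pos (C := C) hℓ hv)
    (y - (v - departures v))).trans_le (measure_mono fun p hp => ?_))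
  have hp' : p.1 (duration C ℓ v) = y - (v - departures v) := hp
  change v - departures v + p.1 (duration C ℓ v) = y
  rw [hp', add_tsub_cancel_of_le hy]

variable [IsProbabilityMeasure ν]

lemma tsum_transition (V : ℕ × ℕ → ℝ≥0∞) (q : ℕ × ℕ) :
    ∑' y, transition C ℓ ν q y * V y = ∫⁻ p, V (nextQueues C ℓ q p) ∂ν := by
  rw [lintegral_comp_eq_tsum ν (measurable_nextQueues C ℓ q)]
  exact tsum_congr fun y => by rw [transition_apply, mul_comm]

lemma IsPoissonLaw.transition_zero_apply (hν : IsPoissonLaw rA rB ν) (hrA : 0 < rA) (y : ℕ × ℕ) :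
    transition C ℓ ν 0 y =
      ∑' v, ν {p | p.1 p.firstArrival = v} * ν {p | serve C ℓ v p = y} := by
  have h := hν.measure_nextQueues_zero (C := C) (ℓ := ℓ) hrA y MeasurableSet.univ
  simp only [Set.mem_univ, and_true, measure_univ, mul_one] at h
  rw [transition_apply, h]

/-- The mean of a quadratic form of the queues after a transmission is finite. -/
lemma IsPoissonLaw.lintegral_quad_nextQueues_ne_top (hν : IsPoissonLaw rA rB ν) (hrA : 0 < rA)
    (hrB : 0 < rB) (α β γ : ℝ≥0) (q : ℕ × ℕ) :
    ∫⁻ p, quad α β γ (nextQueues C ℓ q p) ∂ν ≠ ∞ := by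
  set c : ℝ≥0∞ := ((α + β + γ : ℝ≥0) : ℝ≥0∞) with hc
  set M : ℝ≥0∞ := ∫⁻ p, sumSq (p.1 (totalDuration C ℓ)) ∂ν with hM
  have hMtop : M ≠ ∞ := hν.lintegral_sumSq_ne_top _
  have hctop : c ≠ ∞ := ENNReal.coe_ne_top
  set f : ℕ × ℕ → ℝ≥0∞ := fun v => c * (2 * sumSq v + 2 * M) with hf
  have hfmono : Monotone f := fun v w h => by
    have := sumSq_mono h
    simp only [hf]
    gcongr
  have hftop : ∀ v, f v ≠ ∞ := fun v => ENNReal.mul_ne_top hctop (ENNReal.add_ne_top.2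
    ⟨ENNReal.mul_ne_top (by simp) (sumSq_ne_top v), ENNReal.mul_ne_top (by simp) hMtop⟩)
  have hserve : ∀ v, ∫⁻ p, quad α β γ (serve C ℓ v p) ∂ν ≤ f v := by
    intro v
    calc ∫⁻ p, quad α β γ (serve C ℓ v p) ∂ν
        ≤ ∫⁻ p, c * (2 * sumSq v + 2 * sumSq (p.1 (totalDuration C ℓ))) ∂ν :=
          lintegral_mono fun p => (quad_mono α β γ (serve_le v p)).trans
            ((quad_le α β γ _).trans (mul_le_mul_right (sumSq_add_le _ _) _))
      _ = f v := by
          rw [lintegral_const_mul' _ _ hctop, lintegral_add_left measurable_const,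
            lintegral_const, measure_univ, mul_one, lintegral_const_mul' _ _ (by simp)]
  by_cases hq : q = 0
  · subst hq
    obtain ⟨g, hg, hle⟩ := hν.exists_lintegral_firstArrival_le hrA hrB
    have h1 : ∫⁻ p, quad α β γ (nextQueues C ℓ 0 p) ∂ν ≤ ∫⁻ p, f (p.1 p.firstArrival) ∂ν := by
      rw [← tsum_transition,
        lintegral_comp_eq_tsum ν (measurable_eval_comp measurable_firstArrival) f]
      simp_rw [hν.transition_zero_apply hrA, ← ENNReal.tsum_mul_right]
      rw [ENNReal.tsum_comm]
      refine ENNReal.tsum_le_tsum fun v => ?_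
      simp_rw [mul_assoc]
      rw [ENNReal.tsum_mul_left, mul_comm (f v)]
      gcongr
      refine le_trans (le_of_eq ?_) (hserve v)
      rw [lintegral_comp_eq_tsum ν (measurable_serve C ℓ v)]
      exact tsum_congr fun y => mul_comm _ _
    have h2 : ∫⁻ p, f (p.1 1) ∂ν ≠ ∞ := by
      rw [hf, lintegral_const_mul' _ _ hctop, lintegral_add_right _ measurable_const,
        lintegral_const_mul' _ _ (by simp), lintegral_const, measure_univ, mul_one]
      exact ENNReal.mul_ne_top hctop (ENNReal.add_ne_top.2
        ⟨ENNReal.mul_ne_top (by simp) (hν.lintegral_sumSq_ne_top 1),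
          ENNReal.mul_ne_top (by simp) hMtop⟩)
    exact ne_top_of_le_ne_top (ENNReal.add_ne_top.2 ⟨hftop 0, ENNReal.mul_ne_top hg h2⟩)
      (h1.trans (hle f hfmono))
  · simp only [nextQueues, if_neg hq]
    exact ne_top_of_le_ne_top (hftop q) (hserve q)

/-- The mean of the Lyapunov function decreases by at least `1` from all states with long enough
queues. -/
lemma IsPoissonLaw.exists_drift (hν : IsPoissonLaw rA rB ν) {α β γ : ℝ≥0} {ε : ℝ} (hε : 0 < ε)
    (hdrift : ∀ q : ℕ × ℕ, q ≠ 0 →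
      ε * ((q - departures q).1 + (q - departures q).2) ≤
        (α * (q - departures q).1 + β * (q - departures q).2) *
            ((departures q).1 - rA * duration C ℓ q) +
          (β * (q - departures q).1 + γ * (q - departures q).2) *
            ((departures q).2 - rB * duration C ℓ q)) :
    ∃ F : Finset (ℕ × ℕ), ∀ q ∉ F,
      ∑' y, transition C ℓ ν q y * quad α β γ y + 1 ≤ quad α β γ q := by
  obtain ⟨M, hM⟩ : ∃ M : ℝ≥0, (M : ℝ≥0∞) = ∫⁻ p, quad α β γ (p.1 (totalDuration C ℓ)) ∂ν :=
    ⟨_, ENNReal.coe_toNNReal (hν.lintegral_quad_ne_top α β γ _)⟩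
  -- `M` bounds the quadratic part of the mean change, `2 ε R` is a lower bound for the decrease of
  -- the linear part from queues longer than `R`.
  obtain ⟨R, hR⟩ := exists_nat_ge ((M + 1) / (2 * ε))
  have hR' : (M : ℝ) + 1 ≤ 2 * (ε * R) := by
    rw [div_le_iff₀ (by positivity)] at hR
    linarith
  refine ⟨Finset.range (R + 1) ×ˢ Finset.range (R + 1), fun q hq => ?_⟩
  have hq' : R < q.1 ∨ R < q.2 := by
    simp only [Finset.mem_product, Finset.mem_range] at hq
    omega
  have hq0 : q ≠ 0 := by
    rintro rfl
    simp at hq'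
  have hdle : departures q ≤ q := by
    unfold departures
    constructor <;> split_ifs with h1 h2 h3 <;> simp_all <;> omega
  have hd1 : (departures q).1 ≤ 1 ∧ (departures q).2 ≤ 1 := by
    unfold departures
    split_ifs <;> simp
  have hm : (R : ℝ) ≤ (q - departures q).1 + (q - departures q).2 := by
    have : R ≤ (q - departures q).1 + (q - departures q).2 := by
      simp only [Prod.fst_sub, Prod.snd_sub]
      omega
    exact_mod_cast this
  have hreal := hdrift q hq0
  rw [tsum_transition]
  simp only [nextQueues, if_neg hq0, serve]
  set m := q - departures q with hmdef
  set d := departures q with hddef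
  set s := duration C ℓ q with hs
  have hqm : q = m + d := by
    have h1 := hdle.1
    have h2 := hdle.2
    refine Prod.ext ?_ ?_ <;> simp only [hmdef, Prod.fst_add, Prod.snd_add, Prod.fst_sub,
      Prod.snd_sub] <;> omega
  have hVs : ∫⁻ p, quad α β γ (p.1 s) ∂ν ≤ M := by
    rw [hM]
    exact lintegral_mono fun p => quad_mono α β γ (p.monotone (duration_le q))
  have hlin : 2 * (α * m.1 + β * m.2) * (rA * s) + 2 * (β * m.1 + γ * m.2) * (rB * s) + M + 1 ≤
      2 * (α * m.1 + β * m.2) * d.1 + 2 * (β * m.1 + γ * m.2) * d.2 := by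
    rw [← NNReal.coe_le_coe]
    push_cast
    have := mul_le_mul_of_nonneg_left hm hε.le
    linarith
  have hlin' : (2 * (α * m.1 + β * m.2) * (rA * s : ℝ≥0) + 2 * (β * m.1 + γ * m.2) * (rB * s : ℝ≥0)
      + M + 1 : ℝ≥0∞) ≤ 2 * (α * m.1 + β * m.2) * d.1 + 2 * (β * m.1 + γ * m.2) * d.2 := by
    exact_mod_cast hlin
  rw [hν.lintegral_quad_add]
  calc quad α β γ m + (2 * (α * m.1 + β * m.2) * (rA * s : ℝ≥0) +
          2 * (β * m.1 + γ * m.2) * (rB * s : ℝ≥0)) + ∫⁻ p, quad α β γ (p.1 s) ∂ν + 1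
      ≤ quad α β γ m + (2 * (α * m.1 + β * m.2) * (rA * s : ℝ≥0) +
          2 * (β * m.1 + γ * m.2) * (rB * s : ℝ≥0)) + M + 1 := by gcongr
    _ = quad α β γ m + (2 * (α * m.1 + β * m.2) * (rA * s : ℝ≥0) +
          2 * (β * m.1 + γ * m.2) * (rB * s : ℝ≥0) + M + 1) := by ring
    _ ≤ quad α β γ m + (2 * (α * m.1 + β * m.2) * d.1 + 2 * (β * m.1 + γ * m.2) * d.2) := by
        gcongr
    _ ≤ quad α β γ q := by
        rw [hqm, quad_add]
        exact le_self_add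

lemma IsPoissonLaw.leads_of_ne_zero (hν : IsPoissonLaw rA rB ν) (hrA : 0 < rA) (hrB : 0 < rB)
    (hℓ : 0 < ℓ) {v y : ℕ × ℕ} (hv : v ≠ 0) (hy : v - departures v ≤ y) :
    Leads (transition C ℓ ν) v y := by
  unfold Leads
  rw [transition_apply]
  simp only [nextQueues, if_neg hv]
  exact hν.measure_serve_pos hrA hrB hℓ hv hy

/-- The state to which the empty system is taken by the first arrivals is left as any other nonzero
state. -/
lemma IsPoissonLaw.exists_leads_zero (hν : IsPoissonLaw rA rB ν) (hrA : 0 < rA) (hrB : 0 < rB)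
    (hℓ : 0 < ℓ) : ∃ v : ℕ × ℕ, v ≠ 0 ∧ ∀ y, v - departures v ≤ y →
      Leads (transition C ℓ ν) 0 y := by
  have hex : ∃ v : ℕ × ℕ, v ≠ 0 ∧ ν {p | p.1 p.firstArrival = v} ≠ 0 := by
    by_contra! hcon
    have hsum := measure_eq_tsum_inter_preimage ν
      (measurable_eval_comp measurable_firstArrival) Set.univ
    have hzero : ∀ v : ℕ × ℕ, ν {p | p.1 p.firstArrival = v} = 0 := by
      intro v
      by_cases hv : v = 0
      · refine measure_mono_null (fun p hp => ?_) (hν.ae_hasArrival hrA)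
        exact fun h => h.firstArrival_le_iff.1 le_rfl (hp.trans hv)
      · exact hcon v hv
    have hz : ∀ v : ℕ × ℕ,
        ν (Set.univ ∩ (fun p : ArrivalPath => p.1 p.firstArrival) ⁻¹' {v}) = 0 := fun v => by
      rw [Set.univ_inter]
      exact hzero v
    simp only [hz, tsum_zero, measure_univ] at hsum
    exact one_ne_zero hsum
  obtain ⟨v, hv, hνv⟩ := hex
  refine ⟨v, hv, fun y hy => ?_⟩
  unfold Leads
  rw [hν.transition_zero_apply hrA, Ne, ENNReal.tsum_eq_zero, not_forall]
  exact ⟨v, mul_ne_zero hνv (hν.measure_serve_pos hrA hrB hℓ hv hy)⟩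

/-- All states communicate: without further arrivals, the queues are served until the last
transmission, and during this one, any number of packets can arrive. -/
theorem IsPoissonLaw.transGen_leads (hν : IsPoissonLaw rA rB ν) (hrA : 0 < rA) (hrB : 0 < rB)
    (hℓ : 0 < ℓ) (x y : ℕ × ℕ) : Relation.TransGen (Leads (transition C ℓ ν)) x y := by
  have hne : ∀ (n : ℕ) (x : ℕ × ℕ), x.1 + x.2 ≤ n → x ≠ 0 →
      Relation.TransGen (Leads (transition C ℓ ν)) x y := by
    intro n
    induction n with
    | zero =>
      intro x hx hx0
      exact absurd (Prod.ext (by simp; omega) (by simp; omega)) hx0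
    | succ n ih =>
      intro x hx hx0
      by_cases h : x - departures x = 0
      · exact .single (hν.leads_of_ne_zero hrA hrB hℓ hx0 (by rw [h]; exact zero_le))
      · refine .head (hν.leads_of_ne_zero hrA hrB hℓ hx0 le_rfl) (ih _ ?_ h)
        have hx0' : x.1 ≠ 0 ∨ x.2 ≠ 0 := by
          by_contra! hcon
          exact hx0 (Prod.ext hcon.1 hcon.2)
        simp only [Prod.fst_sub, Prod.snd_sub, departures]
        split_ifs <;> simp only <;> omega
  by_cases hx : x = 0
  · subst hx
    obtain ⟨v, hv, hlead⟩ := hν.exists_leads_zero (C := C) hrA hrB hℓ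
    by_cases h : v - departures v = 0
    · exact .single (hlead y (by rw [h]; exact zero_le))
    · exact .head (hlead _ le_rfl) (hne _ _ le_rfl h)
  · exact hne _ _ le_rfl hx

end Stability

/-- A chain that is a function of `f` is a Markov chain if it is one under the law of `f`. -/
lemma IsMarkovChain.of_map {Ω Ω' S : Type*} [MeasurableSpace Ω] [MeasurableSpace Ω']
    [MeasurableSpace S] [MeasurableSingletonClass S] {μ : Measure Ω} {f : Ω → Ω'}
    (hf : Measurable f) {P : S → PMF S} {x : S} {X : ℕ → Ω' → S}
    (hX : IsMarkovChain (μ.map f) P x X) : IsMarkovChain μ P x fun n ω => X n (f ω) where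
  measurable n := (hX.measurable n).comp hf
  start ω := hX.start (f ω)
  markov n s := by
    have hm : ∀ n, MeasurableSet {ω | ∀ k ≤ n, X k ω = s k} := fun n => by
      have : {ω | ∀ k ≤ n, X k ω = s k} = ⋂ k, ⋂ (_ : k ≤ n), X k ⁻¹' {s k} := by
        ext ω; simp
      rw [this]
      exact .iInter fun k => .iInter fun _ => hX.measurable k (measurableSet_singleton _)
    have h := hX.markov n s
    rw [Measure.map_apply hf (hm _), Measure.map_apply hf (hm _)] at h
    exact h

end TwoWayRelay

end

open TwoWayRelay in
theorem theorem4 {Ω : Type*} [MeasurableSpace Ω] (μ : Measure Ω) [IsProbabilityMeasure μ]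
    (C : TwoWayRelay.Capacities) (ℓ : ℝ≥0) (hℓ : 0 < ℓ) (rA rB : ℝ≥0)
    (NA NB : ℝ≥0 → Ω → ℕ)
    (hA : TwoWayRelay.IsPoissonProcess NA rA μ) (hB : TwoWayRelay.IsPoissonProcess NB rB μ)
    (hAB : IndepFun (fun ω t => NA t ω) (fun ω t => NB t ω) μ)
    (hR : ((rA : ℝ) * (ℓ : ℝ), (rB : ℝ) * (ℓ : ℝ)) ∈
      interior (convexHull ℝ (TwoWayRelay.regionTDMH C ∪ TwoWayRelay.regionMLNC C))) :
    TwoWayRelay.IsStable μ (TwoWayRelay.queues C ℓ NA NB) := by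
  have hl : (0 : ℝ) < ℓ := hℓ
  obtain ⟨hA0, hB0, -, -⟩ := load_lt_one hR
  have hrA : 0 < rA := NNReal.coe_pos.1 (pos_of_mul_pos_left hA0 hl.le)
  have hrB : 0 < rB := NNReal.coe_pos.1 (pos_of_mul_pos_left hB0 hl.le)
  have hN := measurable_arrivals hA hB
  have hν := isPoissonLaw_map_arrivals hA hB hAB
  set ν := μ.map (arrivals hA hB) with hνdef
  have : IsProbabilityMeasure ν := Measure.isProbabilityMeasure_map hN.aemeasurable
  have hchain : ∀ x, IsMarkovChain μ (transition C ℓ ν) x (queues C ℓ NA NB x) := fun x =>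
    (hν.isMarkovChain_orbit (C := C) (ℓ := ℓ) hrA x).of_map hN
  have hreach := hν.transGen_leads (C := C) hrA hrB hℓ
  refine ⟨⟨_, hchain⟩, fun x y => (hchain x).exists_measure_pos (hreach x y), fun x => ?_⟩
  obtain ⟨α, β, γ, ε, hε, hlyap⟩ := exists_lyapunov hℓ hR
  obtain ⟨F, hF⟩ := hν.exists_drift hε hlyap
  refine (hchain x).lintegral_returnTime_lt_top (fun y => hreach y x) (quad α β γ)
    (quad_ne_top α β γ x) F hF fun y _ => ?_
  rw [tsum_transition]
  exact hν.lintegral_quad_nextQueues_ne_top hrA hrB α β γ y
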